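/- Let $G=(V,E,c)$ be a finite undirected graph with positive edge costs. For $S\subseteq V$ let $c(S,V\setminus S)$ be the total cost of the edges between $S$ and $V\setminus S$. For $\alpha\ge 0$ let $G_\alpha$ be obtained from $G$ by adding a vertex $t$ joined to every vertex of $G$ by an edge of cost $\alpha$. For $u\in V$, the community of $u$ in $G_\alpha$ is the side containing $u$ of the minimum $u$-$t$-cut of $G_\alpha$ that has the fewest vertices on the side of $u$. The algorithm CutC (Flake et al.), run on $G_\alpha$, repeatedly picks a vertex $u\in V$ that is not yet covered, computes its community $C$ in $G_\alpha$, discards the clusters found before whose representative lies in $C$, adds $C$ as a cluster with representative $u$, and marks the vertices of $C$ as covered; it returns the remaining clusters, with their representatives, once all of $V$ is covered. For partitions (clusterings) $\Omega,\Omega'$ of $V$ write $\Omega\le\Omega'$ if each cluster of $\Omega$ is contained in a cluster of $\Omega'$, and $\Omega<\Omega'$ if also $\Omega\ne\Omega'$. Let $\omega_S(\alpha)=c(S,V\setminus S)+|S|\,\alpha$ for $S\subseteq V$, $\alpha\ge 0$. The complete hierarchy consists of all clusterings returned by CutC for some $\alpha\ge0$; its elements are called levels. If $\Omega<\Omega'$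 are levels with no level strictly between them, then $\alpha$ is the breakpoint between $\Omega$ and $\Omega'$ if CutC returns $\Omega$ for $\alpha$ and returns $\Omega'$ for $\alpha-\varepsilon$ for all sufficiently small $\varepsilon>0$. **Theorem.** (a) Let $\Omega_i<\Omega_j$ be clusterings returned by CutC for parameter values $\alpha_i>\alpha_j\ge 0$. For each $C\in\Omega_j\setminus\Omega_i$ the set $\{\alpha\ge0 \mid \omega_C(\alpha)=\omega_{C'}(\alpha)\text{ for some } C'\in\Omega_i,\ C'\subsetneq C\}$ has a maximum $\lambda_C$. Put $\alpha_m:=\min_{C\in\Omega_j\setminus\Omega_i}\lambda_C$, and let $\Omega_m$ be the clustering returned by CutC for $\alpha_m$. Then 1. $\alpha_j<\alpha_m\le\alpha_i$; 2. $\Omega_i\le\Omega_m<\Omega_j$; 3. if $\Omega_m=\Omega_i$, then there is no level strictly between $\Omega_i$ and $\Omega_j$, and $\alpha_m$ is the breakpoint between $\Omega_i$ and $\Omega_j$. Moreover, $\alpha_m$ can be computed in $O(|\Omega_i|)$ time on a real random access machine with unit-cost operations: there are a program and a constant $K$, both independent of $G,\alpha_i,\alpha_j,\Omega_i,\Omega_j$,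 such that the program outputs $\alpha_m$ after at most $K|\Omega_i|$ steps, provided that each of the two clusterings is stored as a list of its clusters, each with its representative, its size and the cost $c(C,V\setminus C)$ of its cut, together with an array that gives for each vertex the position in this list of its cluster. (b) Consider the following recursive search. It starts with the clustering $\Omega_0$ into singletons, with parameter value $\alpha_0$ equal to the maximum edge cost ($0$ if there is no edge), and the clustering $\Omega_{\max}$ into connected components, with parameter value $0$; neither requires a call of CutC. For a pair $\Omega_i<\Omega_j$ it computes $\alpha_m$ as in (a) and calls CutC once, for $\alpha_m$; if $\Omega_m=\Omega_i$, it stops on this pair, and otherwise it recurses on the pairs $(\Omega_i,\Omega_m)$ and $(\Omega_m,\Omega_j)$. It does nothing if $\Omega_0=\Omega_{\max}$. This search terminates, the clusterings it has found are exactly all levels of the complete hierarchy, they form a chain $\Omega_0<\dots<\Omega_{\max}$ of clusterings, each returned by CutC for the parameter value found with it, and with $h$ the number of levels it calls CutC at most $2h$ times (exactly $2(h-2)+1$ times if $h\ge2$). -/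

import Mathlib

open scoped NNReal Topology

universe u

/-! ### Weighted graphs, cuts and source communities -/

/-- A finite undirected graph with edge costs on the vertex set `V`. The pair `u, v` is an edge
iff `cost u v` is positive, so that all edge costs are positive. -/
structure CostGraph (V : Type u) where
  cost : V → V → ℝ≥0
  symm : ∀ v w, cost v w = cost w v
  loopless : ∀ v, cost v v = 0

namespace CostGraph

variable {V : Type u}

/-- The underlying simple graph. -/
def graph (G : CostGraph V) : SimpleGraph V where
  Adj v w := 0 < G.cost v w
  symm := ⟨fun v w h => by rw [G.symm w v]; exact h⟩
  loopless := ⟨fun v h => by simp [G.loopless v] at h⟩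

/-- The cost `c(S, V \ S)` of the cut with cut sides `S` and `V \ S`. -/
def cutCost [Fintype V] [DecidableEq V] (G : CostGraph V) (S : Finset V) : ℝ≥0 :=
  ∑ v ∈ S, ∑ w ∈ Sᶜ, G.cost v w

/-- `S` is the source community of `s` with respect to `T`: `S` is the side containing `s` of a
minimum `s`-`T`-cut, and it has the fewest vertices among all such sides. -/
def IsSC [Fintype V] [DecidableEq V] (G : CostGraph V) (s : V) (T S : Finset V) : Prop :=
  (s ∈ S ∧ Disjoint S T) ∧
    (∀ S' : Finset V, s ∈ S' → Disjoint S' T → G.cutCost S ≤ G.cutCost S') ∧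
    (∀ S' : Finset V, s ∈ S' → Disjoint S' T → G.cutCost S' = G.cutCost S → S.card ≤ S'.card)

/-- The augmented graph `G_α`: a new vertex `t` (here `none`) is joined to every vertex of `G` by
an edge of cost `α`. -/
def augment (G : CostGraph V) (α : ℝ≥0) : CostGraph (Option V) where
  cost
    | some v, some w => G.cost v w
    | some _, none => α
    | none, some _ => α
    | none, none => 0
  symm v w := by cases v <;> cases w <;> simp [G.symm]
  loopless v := by cases v <;> simp [G.loopless]

/-- The cut-cost function `ω_S(α) = c(S, V \ S) + |S| α`. -/
def cutFun [Fintype V] [DecidableEq V] (G : CostGraph V) (S : Finset V) (α : ℝ≥0) : ℝ≥0 :=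
  G.cutCost S + S.card * α

/-- The maximum edge cost (`0` if there is no edge). -/
noncomputable def maxCost (G : CostGraph V) : ℝ≥0 := ⨆ e : V × V, G.cost e.1 e.2

end CostGraph

/-! ### Clusterings -/

/-- A family of vertex sets is a clustering if it is a partition of `V`. -/
def IsClustering {V : Type u} [Fintype V] [DecidableEq V] (𝒞 : Finset (Finset V)) : Prop :=
  ∃ P : Finpartition (Finset.univ : Finset V), P.parts = 𝒞

/-- `𝒜 ≤ ℬ`: every cluster of `𝒜` is a subset of a cluster of `ℬ`. -/
def Nested {V : Type u} (𝒜 ℬ : Finset (Finset V)) : Prop :=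
  ∀ A ∈ 𝒜, ∃ B ∈ ℬ, A ⊆ B

/-- `𝒜 < ℬ`: nested and different. -/
def StrictlyNested {V : Type u} (𝒜 ℬ : Finset (Finset V)) : Prop :=
  Nested 𝒜 ℬ ∧ 𝒜 ≠ ℬ

/-- The clusters of a family of pairs `(C, r(C))` consisting of a cluster and its
representative. -/
def clusters {V : Type u} [DecidableEq V] (Ω : Finset (Finset V × V)) : Finset (Finset V) :=
  Ω.image Prod.fst

namespace CostGraph

variable {V : Type u} [Fintype V] [DecidableEq V]

/-! ### The algorithm CutC -/

/-- One pass through the main loop of CutC on `G_α`. A state consists of the set of vertices that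
are not yet covered and of the current family of pairs `(C, r(C))`. An arbitrary uncovered vertex
`v` is chosen, its source community `C` with respect to `t` in `G_α` is computed, the clusters
whose representative lies in `C` are discarded, `C` is added with representative `v`, and the
vertices of `C` are marked as covered. -/
inductive CutCStep (G : CostGraph V) (α : ℝ≥0) :
    Finset V × Finset (Finset V × V) → Finset V × Finset (Finset V × V) → Prop
  | pass (R : Finset V) (Ω : Finset (Finset V × V)) (v : V) (C : Finset V) (hv : v ∈ R)
      (hC : (G.augment α).IsSC (some v) {none} (C.map Function.Embedding.some)) :
      CutCStep G α (R, Ω) (R \ C, insert (C, v) (Ω.filter fun p => p.2 ∉ C))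

/-- `Ω` is the output (clusters with representatives) of a complete run of CutC on `G_α`. -/
def CutC (G : CostGraph V) (α : ℝ≥0) (Ω : Finset (Finset V × V)) : Prop :=
  Relation.ReflTransGen (G.CutCStep α) (Finset.univ, ∅) (∅, Ω)

/-- CutC returns the clustering `𝒞` for the parameter value `α`, whatever vertices it chooses. -/
def CutCReturns (G : CostGraph V) (α : ℝ≥0) (𝒞 : Finset (Finset V)) : Prop :=
  (∃ Ω, G.CutC α Ω) ∧ ∀ Ω, G.CutC α Ω → clusters Ω = 𝒞

/-- The clusterings that can be obtained by CutC for some parameter value; these are the levels of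
the complete hierarchy. -/
def cutClusterings (G : CostGraph V) : Set (Finset (Finset V)) :=
  {𝒞 | ∃ α Ω, G.CutC α Ω ∧ clusters Ω = 𝒞}

/-- `𝒜 < ℬ` are consecutive levels of the complete hierarchy. -/
def Consecutive (G : CostGraph V) (𝒜 ℬ : Finset (Finset V)) : Prop :=
  𝒜 ∈ G.cutClusterings ∧ ℬ ∈ G.cutClusterings ∧ StrictlyNested 𝒜 ℬ ∧
    ∀ 𝒞 ∈ G.cutClusterings, ¬ (StrictlyNested 𝒜 𝒞 ∧ StrictlyNested 𝒞 ℬ)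

/-- `α` is the breakpoint between `𝒜` and `ℬ`: these are consecutive levels, and CutC returns `𝒜`
for `α` and `ℬ` for `α - ε` whenever `ε > 0` is small enough. -/
def IsBreakpoint (G : CostGraph V) (𝒜 ℬ : Finset (Finset V)) (α : ℝ≥0) : Prop :=
  G.Consecutive 𝒜 ℬ ∧ G.CutCReturns α 𝒜 ∧ ∀ᶠ β in 𝓝[<] α, G.CutCReturns β ℬ

/-! ### The candidate value -/

/-- The intersection points of the cut-cost function of `C` with those of its children in `𝒜`. -/
def intersections (G : CostGraph V) (𝒜 : Finset (Finset V)) (C : Finset V) : Set ℝ≥0 :=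
  {α | ∃ C' ∈ 𝒜, C' ⊂ C ∧ G.cutFun C α = G.cutFun C' α}

/-- `α` is the minimum, over the parents `C ∈ ℬ`, of the maximum intersection point of the cut-cost
function of `C` with the cut-cost functions of its children in `𝒜`. -/
def IsCandidate (G : CostGraph V) (𝒜 ℬ : Finset (Finset V)) (α : ℝ≥0) : Prop :=
  IsLeast {l | ∃ C ∈ ℬ, IsGreatest (G.intersections 𝒜 C) l} α

/-! ### The parametric search -/

/-- The clustering into singletons. -/
def singletons (_G : CostGraph V) : Finset (Finset V) :=
  Finset.univ.image fun v => {v}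

open Classical in
/-- The clustering into connected components. -/
noncomputable def components (G : CostGraph V) : Finset (Finset V) :=
  Finset.univ.image fun v => Finset.univ.filter fun w => G.graph.Reachable v w

end CostGraph

/-- A state of the parametric search: the pairs of levels (a level is a parameter value with a
clustering) between which the search still has to be carried out, from the bottom upwards, the
sequence of the levels output so far, and the number of calls of CutC made so far. -/
structure SearchState (V : Type u) where
  todo : List ((ℝ≥0 × Finset (Finset V)) × (ℝ≥0 × Finset (Finset V)))
  levels : List (ℝ≥0 × Finset (Finset V))
  calls : ℕ

namespace CostGraph

variable {V : Type u} [Fintype V] [DecidableEq V]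

open Classical in
/-- The search starts from the two trivial clusterings, which are obtained without CutC: the
singletons, for the maximum edge cost, and the connected components, for the value `0`. -/
noncomputable def searchStart (G : CostGraph V) : SearchState V where
  todo := if G.singletons = G.components then []
    else [((G.maxCost, G.singletons), (0, G.components))]
  levels := [(G.maxCost, G.singletons)]
  calls := 0

/-- One step of the recursive search, for the pair of levels `L`, `U`: compute the candidate `α`
and call CutC once, for `α`. If this returns the lower clustering, then `α` is taken as the
breakpoint between `L` and `U`, and `U` is output as the next level. Otherwise the recursion
branches at the new level. -/
inductive SearchStep (G : CostGraph V) : SearchState V → SearchState V → Prop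
  | advance (L U : ℝ≥0 × Finset (Finset V)) (rest out n) (α : ℝ≥0) (Ω : Finset (Finset V × V))
      (hα : G.IsCandidate L.2 U.2 α) (hΩ : G.CutC α Ω) (h : clusters Ω = L.2) :
      SearchStep G ⟨(L, U) :: rest, out, n⟩ ⟨rest, out ++ [U], n + 1⟩
  | branch (L U : ℝ≥0 × Finset (Finset V)) (rest out n) (α : ℝ≥0) (Ω : Finset (Finset V × V))
      (hα : G.IsCandidate L.2 U.2 α) (hΩ : G.CutC α Ω) (h : clusters Ω ≠ L.2) :
      SearchStep G ⟨(L, U) :: rest, out, n⟩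
        ⟨(L, (α, clusters Ω)) :: ((α, clusters Ω), U) :: rest, out, n + 1⟩

end CostGraph

/-! ### A real random access machine with a step count -/

namespace RAM

/-- The memory: registers and arrays of natural numbers, registers and arrays of reals. -/
structure Mem where
  nat : ℕ → ℕ
  real : ℕ → ℝ
  natArr : ℕ → ℕ → ℕ
  realArr : ℕ → ℕ → ℝ

/-- The elementary instructions, each of which takes one step. -/
inductive Instr
  | natConst (x k : ℕ)
  | natCopy (x y : ℕ)
  | natAdd (x y z : ℕ)
  | natSub (x y z : ℕ)
  | natLoad (x a y : ℕ)
  | natStore (a x y : ℕ)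
  | realOfNat (r x : ℕ)
  | realCopy (r s : ℕ)
  | realAdd (r s q : ℕ)
  | realSub (r s q : ℕ)
  | realMul (r s q : ℕ)
  | realDiv (r s q : ℕ)
  | realLoad (r a x : ℕ)
  | realStore (a x r : ℕ)

/-- The effect of an elementary instruction. -/
noncomputable def Instr.run : Instr → Mem → Mem
  | natConst x k, m => { m with nat := Function.update m.nat x k }
  | natCopy x y, m => { m with nat := Function.update m.nat x (m.nat y) }
  | natAdd x y z, m => { m with nat := Function.update m.nat x (m.nat y + m.nat z) }
  | natSub x y z, m => { m with nat := Function.update m.nat x (m.nat y - m.nat z) }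
  | natLoad x a y, m => { m with nat := Function.update m.nat x (m.natArr a (m.nat y)) }
  | natStore a x y, m =>
      { m with
        natArr :=
          Function.update m.natArr a (Function.update (m.natArr a) (m.nat x) (m.nat y)) }
  | realOfNat r x, m => { m with real := Function.update m.real r (m.nat x : ℝ) }
  | realCopy r s, m => { m with real := Function.update m.real r (m.real s) }
  | realAdd r s q, m => { m with real := Function.update m.real r (m.real s + m.real q) }
  | realSub r s q, m => { m with real := Function.update m.real r (m.real s - m.real q) }
  | realMul r s q, m => { m with real := Function.update m.real r (m.real s * m.real q) }
  | realDiv r s q, m => { m with real := Function.update m.real r (m.real s / m.real q) }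
  | realLoad r a x, m => { m with real := Function.update m.real r (m.realArr a (m.nat x)) }
  | realStore a x r, m =>
      { m with
        realArr :=
          Function.update m.realArr a (Function.update (m.realArr a) (m.nat x) (m.real r)) }

/-- The tests, each of which takes one step. -/
inductive Test
  | natLt (x y : ℕ)
  | natEq (x y : ℕ)
  | realLt (r s : ℕ)

/-- The truth of a test. -/
def Test.Holds : Test → Mem → Prop
  | natLt x y, m => m.nat x < m.nat y
  | natEq x y, m => m.nat x = m.nat y
  | realLt r s, m => m.real r < m.real s

/-- Programs. -/
inductive Prog
  | instr (i : Instr)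
  | seq (P Q : Prog)
  | cond (b : Test) (P Q : Prog)
  | loop (b : Test) (P : Prog)

/-- `Exec P m m' n`: started in the memory `m`, the program `P` halts after exactly `n` steps with
the memory `m'`. Here `loop b P` repeats `P` as long as the test `b` holds. -/
inductive Exec : Prog → Mem → Mem → ℕ → Prop
  | instr (i m) : Exec (.instr i) m (i.run m) 1
  | seq (P Q m₁ m₂ m₃ a b) (hP : Exec P m₁ m₂ a) (hQ : Exec Q m₂ m₃ b) :
      Exec (.seq P Q) m₁ m₃ (a + b)
  | condTrue (b P Q m m' n) (hb : b.Holds m) (hP : Exec P m m' n) :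
      Exec (.cond b P Q) m m' (n + 1)
  | condFalse (b P Q m m' n) (hb : ¬ b.Holds m) (hQ : Exec Q m m' n) :
      Exec (.cond b P Q) m m' (n + 1)
  | loopFalse (b P m) (hb : ¬ b.Holds m) : Exec (.loop b P) m m 1
  | loopTrue (b P m₁ m₂ m₃ n k) (hb : b.Holds m₁) (hP : Exec P m₁ m₂ n)
      (hL : Exec (.loop b P) m₂ m₃ k) : Exec (.loop b P) m₁ m₃ (n + k + 1)

/-- The memory `m` holds the clustering `Ω`, for the numbering `num` of the vertices: the natural
register `x` holds the number of clusters; for the cluster at position `p` of a list of all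
clusters, entry `p` of the natural array `rep` holds the number of its representative, entry `p` of
the natural array `size` its size, and entry `p` of the real array `cost` the cost of the cut that
it induces; for each vertex `v`, entry `num v` of the natural array `pos` holds the position of the
cluster that contains `v`. -/
def Stores {V : Type u} [Fintype V] [DecidableEq V] (G : CostGraph V) (num : V → ℕ)
    (Ω : Finset (Finset V × V)) (x rep size pos cost : ℕ) (m : Mem) : Prop :=
  m.nat x = Ω.card ∧
    ∃ list : Fin Ω.card ≃ {q // q ∈ Ω}, ∀ p : Fin Ω.card,
      m.natArr rep p = num (list p).1.2 ∧
      m.natArr size p = (list p).1.1.card ∧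
      m.realArr cost p = G.cutCost (list p).1.1 ∧
      ∀ v ∈ (list p).1.1, m.natArr pos (num v) = p

/-- The input of the computation: both clusterings are stored, with respect to the same numbering
of the vertices; the other memory cells are arbitrary. -/
def IsInput {V : Type u} [Fintype V] [DecidableEq V] (G : CostGraph V)
    (Ωi Ωj : Finset (Finset V × V)) (m : Mem) : Prop :=
  ∃ num : V ≃ Fin (Fintype.card V),
    Stores G (fun v => (num v : ℕ)) Ωi 0 0 1 2 0 m ∧
    Stores G (fun v => (num v : ℕ)) Ωj 1 3 4 5 1 m

end RAM

/-! The cut function is submodular and symmetric, hence also posimodular. Combined with the choice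
of the smallest minimum cut, this controls how communities meet. If `u` lies in a community for a
parameter `β ≤ α`, its own community for `α` is contained in that one (`IsCommunity.subset_of_mem`);
two communities for the same `α`, neither containing the other's representative, are disjoint
(`IsCommunity.disjoint_of_notMem`). Hence CutC always yields a partition, independent of its
choices, which gets coarser as `α` decreases (`CutC.nested`).

For `C' ⊂ C` the line `ω_C` is steeper than `ω_C'`, so `C` is strictly cheaper exactly to the left
of their crossing. A cluster `C` returned for `β` must beat the child containing its representative,
so some crossing exceeds `β`; a child `C'` returned for `α` is at most as expensive as `C`, so the
crossing is at most `α`. These two facts place `α_m` and show that the upper clustering is not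
returned there. If the lower clustering is returned for `α_m`, every maximal crossing equals `α_m`,
and a cluster strictly between a child and its parent at a smaller parameter would have to cross the
parent both at or above `α_m` and below it (`IsCandidate.clusters_eq_of_lt`). So nothing lies in
between.

For the running time, one pass over the children updates a running maximum for each parent, and one
pass over the parents takes the minimum; there are at most as many parents as children.

The search keeps a chain of found levels such that every missing level lies strictly inside a
pending pair. Each call either closes a pair or finds a new level, so calls are counted by levels
found plus levels output (`SearchInvariant.step`); this gives both termination and the exact number
of calls. -/

namespace CostGraph

variable {V : Type u} [Fintype V] [DecidableEq V]

/-! ### Cut functions -/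

theorem cutCost_eq_sum_ite (G : CostGraph V) (S : Finset V) :
    G.cutCost S = ∑ v, ∑ w, if v ∈ S ∧ w ∉ S then G.cost v w else 0 := by
  unfold cutCost
  rw [← Finset.sum_filter_add_sum_filter_not Finset.univ (· ∈ S)]
  rw [Finset.sum_eq_zero (s := Finset.univ.filter (· ∉ S)), add_zero]
  · have : (Finset.univ.filter (· ∈ S)) = S := by ext; simp
    rw [this]
    refine Finset.sum_congr rfl fun v hv => ?_
    rw [← Finset.sum_filter]
    refine Finset.sum_congr ?_ fun _ _ => rfl
    ext w; simp [hv]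
  · intro v hv
    have hv' : v ∉ S := by simpa using hv
    simp [hv']

/-- Submodularity holds separately for each ordered pair of vertices, by cases on their membership
in `A` and `B`. -/
theorem cutCost_inter_add_union_le (G : CostGraph V) (A B : Finset V) :
    G.cutCost (A ∩ B) + G.cutCost (A ∪ B) ≤ G.cutCost A + G.cutCost B := by
  simp only [cutCost_eq_sum_ite, ← Finset.sum_add_distrib]
  refine Finset.sum_le_sum fun v _ => Finset.sum_le_sum fun w _ => ?_
  by_cases h1 : v ∈ A <;> by_cases h2 : v ∈ B <;> by_cases h3 : w ∈ A <;> by_cases h4 : w ∈ B <;>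
    simp [h1, h2, h3, h4]

theorem cutCost_compl (G : CostGraph V) (S : Finset V) : G.cutCost Sᶜ = G.cutCost S := by
  unfold cutCost
  rw [Finset.sum_comm, compl_compl]
  exact Finset.sum_congr rfl fun v _ => Finset.sum_congr rfl fun w _ => G.symm _ _

/-- Posimodularity is submodularity for `A` and the complement of `B`, because a set and its
complement induce the same cut. -/
theorem cutCost_sdiff_add_sdiff_le (G : CostGraph V) (A B : Finset V) :
    G.cutCost (A \ B) + G.cutCost (B \ A) ≤ G.cutCost A + G.cutCost B := by
  have h := G.cutCost_inter_add_union_le A Bᶜ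
  have h1 : A ∩ Bᶜ = A \ B := by ext; simp
  have h2 : A ∪ Bᶜ = (B \ A)ᶜ := by ext; simp; tauto
  rwa [h1, h2, cutCost_compl, cutCost_compl] at h

theorem cutCost_augment_map_some (G : CostGraph V) (α : ℝ≥0) (S : Finset V) :
    (G.augment α).cutCost (S.map Function.Embedding.some) = G.cutFun S α := by
  have hc : (S.map Function.Embedding.some)ᶜ =
      insert (none : Option V) (Sᶜ.map Function.Embedding.some) := by
    ext x; cases x <;> simp
  unfold cutCost cutFun
  rw [hc, Finset.sum_map]
  have : ∀ v ∈ S, ∑ w ∈ insert (none : Option V) (Sᶜ.map Function.Embedding.some),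
      (G.augment α).cost (Function.Embedding.some v) w = α + ∑ w ∈ Sᶜ, G.cost v w := by
    intro v _
    rw [Finset.sum_insert (by simp), Finset.sum_map]
    rfl
  rw [Finset.sum_congr rfl this, Finset.sum_add_distrib, Finset.sum_const, nsmul_eq_mul, add_comm]
  rfl

/-! ### Communities -/

/-- `C` is the community of `v` in `G_α`, in terms of the cut-cost functions. -/
structure IsCommunity (G : CostGraph V) (α : ℝ≥0) (v : V) (C : Finset V) : Prop where
  mem : v ∈ C
  le : ∀ S : Finset V, v ∈ S → G.cutFun C α ≤ G.cutFun S α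
  card_le : ∀ S : Finset V, v ∈ S → G.cutFun S α = G.cutFun C α → C.card ≤ S.card

/-- The sets avoiding `t` are exactly the images of subsets of `V`, and each vertex of such a set
pays `α` for its edge to `t`. From here on the augmented graph is no longer needed. -/
theorem isSC_augment_iff {G : CostGraph V} {α : ℝ≥0} {v : V} {C : Finset V} :
    (G.augment α).IsSC (some v) {none} (C.map Function.Embedding.some) ↔
      G.IsCommunity α v C := by
  have key : ∀ S' : Finset (Option V), Disjoint S' {none} →
      ∃ S : Finset V, S' = S.map Function.Embedding.some := by
    intro S' h
    refine ⟨S'.eraseNone, ?_⟩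
    rw [Finset.map_some_eraseNone, Finset.erase_eq_of_notMem]
    simpa using h
  constructor
  · rintro ⟨⟨h1, -⟩, h2, h3⟩
    refine ⟨by simpa using h1, fun S hS => ?_, fun S hS hE => ?_⟩
    · simpa only [cutCost_augment_map_some] using
        h2 (S.map Function.Embedding.some) (by simpa using hS) (by simp)
    · simpa only [Finset.card_map] using
        h3 (S.map Function.Embedding.some) (by simpa using hS) (by simp)
          (by simpa only [cutCost_augment_map_some] using hE)
  · rintro ⟨h1, h2, h3⟩
    refine ⟨⟨by simpa using h1, by simp⟩, fun S' hS hd => ?_, fun S' hS hd hE => ?_⟩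
    · obtain ⟨S, rfl⟩ := key S' hd
      simpa only [cutCost_augment_map_some] using h2 S (by simpa using hS)
    · obtain ⟨S, rfl⟩ := key S' hd
      simpa only [Finset.card_map] using
        h3 S (by simpa using hS) (by simpa only [cutCost_augment_map_some] using hE)

theorem exists_isCommunity (G : CostGraph V) (α : ℝ≥0) (v : V) : ∃ C, G.IsCommunity α v C := by
  obtain ⟨A, hA, hmin⟩ := Finset.exists_min_image
    (Finset.univ.filter fun S : Finset V => v ∈ S) (fun S => G.cutFun S α) ⟨{v}, by simp⟩
  obtain ⟨C, hC, hcard⟩ := Finset.exists_min_image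
    (Finset.univ.filter fun S : Finset V => v ∈ S ∧ G.cutFun S α = G.cutFun A α)
    Finset.card ⟨A, by simpa using hA⟩
  simp only [Finset.mem_filter, Finset.mem_univ, true_and] at *
  exact ⟨C, hC.1, fun S hS => hC.2 ▸ hmin S hS, fun S hS hE => hcard S ⟨hS, hE.trans hC.2⟩⟩

namespace IsCommunity

variable {G : CostGraph V} {α β : ℝ≥0} {u v : V} {A B S : Finset V}

/-- A tie would contradict the minimal number of vertices. This is the source of the strict
inequality `α_j < α_m`. -/
theorem lt_of_ssubset (hA : G.IsCommunity α u A) (hu : u ∈ S) (hS : S ⊂ A) :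
    G.cutFun A α < G.cutFun S α :=
  lt_of_le_of_ne (hA.le S hu) fun h =>
    absurd (hA.card_le S hu h.symm) (not_le.2 (Finset.card_lt_card hS))

/-- Uncrossing: `A ∩ B` competes with `A` at `α`, and `A ∪ B` competes with `B` at `β`. Passing to
them moves the vertices of `A \ B` from price `α` to the lower price `β`, so by submodularity `A ∩
B` ties with `A`; minimal cardinality then forces `A \ B` to be empty. -/
theorem subset_of_mem (hA : G.IsCommunity α u A) (hB : G.IsCommunity β v B) (hβ : β ≤ α)
    (hu : u ∈ B) : A ⊆ B := by
  have h1 := hA.le (A ∩ B) (by simp [hA.mem, hu])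
  have h2 := hB.le (A ∪ B) (by simp [hB.mem])
  have h3 := G.cutCost_inter_add_union_le A B
  have h4 := hA.card_le (A ∩ B) (by simp [hA.mem, hu])
  have c1 : (A ∩ B).card + (A \ B).card = A.card := Finset.card_inter_add_card_sdiff A B
  have c2 : (A ∪ B).card = (A \ B).card + B.card := (Finset.card_sdiff_add_card A B).symm
  have hm : β * (A \ B).card ≤ α * (A \ B).card := by gcongr
  unfold cutFun at *
  rw [c2] at h2
  rw [← c1] at h1 h4
  have hle := h4 (by
    simp only [← NNReal.coe_le_coe, ← NNReal.coe_inj] at *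
    push_cast at *
    apply le_antisymm <;> nlinarith)
  have : (A \ B).card = 0 := by omega
  exact Finset.sdiff_eq_empty_iff_subset.1 (Finset.card_eq_zero.1 this)

/-- Here `A \ B` and `B \ A` are the competitors. By posimodularity, and since dropping `A ∩ B` from
both sides only saves cost, `A \ B` ties with `A`; minimal cardinality makes `A ∩ B` empty. -/
theorem disjoint_of_notMem (hA : G.IsCommunity α u A) (hB : G.IsCommunity α v B)
    (hu : u ∉ B) (hv : v ∉ A) : Disjoint A B := by
  have h1 := hA.le (A \ B) (by simp [hA.mem, hu])
  have h2 := hB.le (B \ A) (by simp [hB.mem, hv])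
  have h3 := G.cutCost_sdiff_add_sdiff_le A B
  have h4 := hA.card_le (A \ B) (by simp [hA.mem, hu])
  have c1 : (A ∩ B).card + (A \ B).card = A.card := Finset.card_inter_add_card_sdiff A B
  have c2 : (B ∩ A).card + (B \ A).card = B.card := Finset.card_inter_add_card_sdiff B A
  have hm : 0 ≤ α * (A ∩ B).card := zero_le
  rw [Finset.inter_comm] at c2
  unfold cutFun at *
  rw [← c2] at h2
  rw [← c1] at h1 h4
  have hle := h4 (by
    simp only [← NNReal.coe_le_coe, ← NNReal.coe_inj] at *
    push_cast at *
    apply le_antisymm <;> nlinarith)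
  have : (A ∩ B).card = 0 := by omega
  exact Finset.disjoint_iff_inter_eq_empty.2 (Finset.card_eq_zero.1 this)

end IsCommunity

/-! ### Outputs of CutC -/

/-- The pairs `(C, r(C))` in `Ω` are disjoint communities with their representatives, and they
cover the complement of `R`. -/
structure IsPartialOutput (G : CostGraph V) (α : ℝ≥0) (R : Finset V)
    (Ω : Finset (Finset V × V)) : Prop where
  community : ∀ p ∈ Ω, G.IsCommunity α p.2 p.1
  disjoint : ∀ p ∈ Ω, ∀ q ∈ Ω, p ≠ q → Disjoint p.1 q.1
  notMem_iff : ∀ v, v ∉ R ↔ ∃ p ∈ Ω, v ∈ p.1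

theorem IsPartialOutput.step {G : CostGraph V} {α : ℝ≥0} {s s' : Finset V × Finset (Finset V × V)}
    (h : G.IsPartialOutput α s.1 s.2) (hs : G.CutCStep α s s') :
    G.IsPartialOutput α s'.1 s'.2 := by
  obtain ⟨R, Ω, v, C, hv, hC⟩ := hs
  rw [isSC_augment_iff] at hC
  -- The new representative was uncovered, so it lies in no old cluster; a kept cluster has its
  -- representative outside `C`. These are the two hypotheses of the disjointness lemma.
  have hd : ∀ p ∈ Ω, p.2 ∉ C → Disjoint C p.1 := fun p hp hpC =>
    hC.disjoint_of_notMem (h.community p hp)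
      (fun hvp => (h.notMem_iff v).2 ⟨p, hp, hvp⟩ hv) hpC
  refine ⟨fun p hp => ?_, fun p hp q hq hpq => ?_, fun w => ?_⟩
  · rcases Finset.mem_insert.1 hp with rfl | hp
    · exact hC
    · exact h.community p (Finset.mem_filter.1 hp).1
  · simp only [Finset.mem_insert, Finset.mem_filter] at hp hq
    rcases hp with rfl | hp <;> rcases hq with rfl | hq
    · exact absurd rfl hpq
    · exact hd q hq.1 hq.2
    · exact (hd p hp.1 hp.2).symm
    · exact h.disjoint p hp.1 q hq.1 hpq
  · simp only [Finset.mem_insert, Finset.mem_filter, Finset.mem_sdiff, not_and, not_not]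
    constructor
    · intro hw
      by_cases hwC : w ∈ C
      · exact ⟨_, Or.inl rfl, hwC⟩
      · obtain ⟨p, hp, hwp⟩ := (h.notMem_iff w).1 fun hwR => hwC (hw hwR)
        -- A discarded cluster has its representative in `C` and is therefore contained in `C`, so
        -- discarding uncovers no vertex.
        exact ⟨p, Or.inr ⟨hp, fun hpC =>
          hwC ((h.community p hp).subset_of_mem hC le_rfl hpC hwp)⟩, hwp⟩
    · rintro ⟨p, rfl | hp, hwp⟩ hwR
      · exact hwp
      · exact absurd hwR ((h.notMem_iff w).2 ⟨p, hp.1, hwp⟩)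

theorem CutC.isPartialOutput {G : CostGraph V} {α : ℝ≥0} {Ω : Finset (Finset V × V)}
    (h : G.CutC α Ω) : G.IsPartialOutput α ∅ Ω := by
  have key : ∀ s, Relation.ReflTransGen (G.CutCStep α) (Finset.univ, ∅) s →
      G.IsPartialOutput α s.1 s.2 := by
    intro s hs
    induction hs with
    | refl => exact ⟨by simp, by simp, by simp⟩
    | tail _ hst ih => exact ih.step hst
  exact key _ h

/-- Every pass covers at least the chosen vertex, so the uncovered set shrinks strictly. -/
theorem exists_cutC (G : CostGraph V) (α : ℝ≥0) : ∃ Ω, G.CutC α Ω := by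
  have key : ∀ n, ∀ R : Finset V, R.card = n → ∀ Ω,
      ∃ Ω', Relation.ReflTransGen (G.CutCStep α) (R, Ω) (∅, Ω') := by
    intro n
    induction n using Nat.strong_induction_on with
    | _ n ih =>
      intro R hR Ω
      rcases R.eq_empty_or_nonempty with rfl | ⟨v, hv⟩
      · exact ⟨Ω, .refl⟩
      · obtain ⟨C, hC⟩ := G.exists_isCommunity α v
        have hlt : (R \ C).card < n := hR ▸ Finset.card_lt_card
          (Finset.ssubset_iff_of_subset Finset.sdiff_subset |>.2 ⟨v, hv, by simp [hC.mem]⟩)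
        obtain ⟨Ω', hΩ'⟩ := ih _ hlt (R \ C) rfl (insert (C, v) (Ω.filter fun p => p.2 ∉ C))
        exact ⟨Ω', .head (.pass R Ω v C hv (isSC_augment_iff.2 hC)) hΩ'⟩
  exact key _ _ rfl ∅

end CostGraph

/-! ### Nested clusterings -/

theorem mem_clusters {V : Type u} [DecidableEq V] {Ω : Finset (Finset V × V)} {C : Finset V} :
    C ∈ clusters Ω ↔ ∃ v, (C, v) ∈ Ω := by
  simp [clusters]

section Nested

variable {V : Type u} {𝒜 ℬ 𝒞 : Finset (Finset V)}

theorem Nested.trans (h₁ : Nested 𝒜 ℬ) (h₂ : Nested ℬ 𝒞) : Nested 𝒜 𝒞 := fun A hA => by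
  obtain ⟨B, hB, hAB⟩ := h₁ A hA
  obtain ⟨C, hC, hBC⟩ := h₂ B hB
  exact ⟨C, hC, hAB.trans hBC⟩

variable [Fintype V] [DecidableEq V]

theorem IsClustering.nested_antisymm (hA : IsClustering 𝒜) (hB : IsClustering ℬ)
    (h₁ : Nested 𝒜 ℬ) (h₂ : Nested ℬ 𝒜) : 𝒜 = ℬ := by
  obtain ⟨P, rfl⟩ := hA
  obtain ⟨Q, rfl⟩ := hB
  have : P = Q := le_antisymm (fun A hA => h₁ A hA) (fun A hA => h₂ A hA)
  rw [this]

theorem IsClustering.eq_of_mem (hA : IsClustering 𝒜) {A B : Finset V} (h₁ : A ∈ 𝒜) (h₂ : B ∈ 𝒜)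
    {v : V} (hvA : v ∈ A) (hvB : v ∈ B) : A = B := by
  obtain ⟨P, rfl⟩ := hA
  exact P.eq_of_mem_parts h₁ h₂ hvA hvB

theorem IsClustering.exists_mem (hA : IsClustering 𝒜) (v : V) : ∃ A ∈ 𝒜, v ∈ A := by
  obtain ⟨P, rfl⟩ := hA
  exact P.exists_mem (Finset.mem_univ v)

theorem IsClustering.nonempty (hA : IsClustering 𝒜) {A : Finset V} (h : A ∈ 𝒜) : A.Nonempty := by
  obtain ⟨P, rfl⟩ := hA
  exact P.nonempty_of_mem_parts h

theorem IsClustering.card_le (hA : IsClustering 𝒜) (hB : IsClustering ℬ) (h : Nested 𝒜 ℬ) :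
    ℬ.card ≤ 𝒜.card := by
  obtain ⟨P, rfl⟩ := hA
  obtain ⟨Q, rfl⟩ := hB
  exact Finpartition.card_mono (show P ≤ Q from fun A hA => h A hA)

theorem StrictlyNested.trans_nested (hA : IsClustering 𝒜) (hB : IsClustering ℬ)
    (h₁ : StrictlyNested 𝒜 ℬ) (h₂ : Nested ℬ 𝒞) : StrictlyNested 𝒜 𝒞 :=
  ⟨h₁.1.trans h₂, fun h => h₁.2 (hA.nested_antisymm hB h₁.1 (h ▸ h₂))⟩

theorem Nested.trans_strictlyNested (hB : IsClustering ℬ) (hC : IsClustering 𝒞)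
    (h₁ : Nested 𝒜 ℬ) (h₂ : StrictlyNested ℬ 𝒞) : StrictlyNested 𝒜 𝒞 :=
  ⟨h₁.trans h₂.1, fun h => h₂.2 (hB.nested_antisymm hC h₂.1 (h ▸ h₁))⟩

end Nested

/-! ### Clusterings returned by CutC and their monotonicity in the parameter -/

namespace CostGraph

variable {V : Type u} [Fintype V] [DecidableEq V]
variable {G : CostGraph V} {α β : ℝ≥0} {Ω Ω' : Finset (Finset V × V)}

theorem CutC.exists_isCommunity (h : G.CutC α Ω) {C : Finset V} (hC : C ∈ clusters Ω) :
    ∃ v, G.IsCommunity α v C := by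
  obtain ⟨v, hv⟩ := mem_clusters.1 hC
  exact ⟨v, h.isPartialOutput.community _ hv⟩

theorem CutC.eq_of_mem (h : G.CutC α Ω) {p q : Finset V × V} (hp : p ∈ Ω) (hq : q ∈ Ω) {v : V}
    (hvp : v ∈ p.1) (hvq : v ∈ q.1) : p = q := by
  by_contra hne
  exact Finset.disjoint_left.1 (h.isPartialOutput.disjoint p hp q hq hne) hvp hvq

theorem CutC.card_clusters (h : G.CutC α Ω) : (clusters Ω).card = Ω.card :=
  Finset.card_image_of_injOn fun p hp q hq hpq =>
    have hm := (h.isPartialOutput.community p hp).mem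
    h.eq_of_mem hp hq hm (by rw [← hpq]; exact hm)

theorem CutC.isClustering (h : G.CutC α Ω) : IsClustering (clusters Ω) := by
  have ho := h.isPartialOutput
  refine ⟨Finpartition.ofExistsUnique (clusters Ω) (fun _ _ => Finset.subset_univ _)
    (fun v _ => ?_) (fun he => ?_), rfl⟩
  · obtain ⟨p, hp, hvp⟩ := (ho.notMem_iff v).1 (by simp)
    refine ⟨p.1, ⟨mem_clusters.2 ⟨p.2, hp⟩, hvp⟩, ?_⟩
    rintro C ⟨hC, hvC⟩
    obtain ⟨w, hw⟩ := mem_clusters.1 hC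
    rw [h.eq_of_mem hp hw hvp hvC]
  · obtain ⟨v, hv⟩ := h.exists_isCommunity he
    exact absurd hv.mem (Finset.notMem_empty v)

/-- A cluster is the community of its representative, hence lies in whichever cluster for the
smaller parameter contains that vertex. The case of equal parameters shows that the output does not
depend on the choices of CutC. -/
theorem CutC.nested (h : G.CutC α Ω) (h' : G.CutC β Ω') (hβ : β ≤ α) :
    Nested (clusters Ω) (clusters Ω') := by
  intro C hC
  obtain ⟨v, hv⟩ := h.exists_isCommunity hC
  obtain ⟨D, hD, hvD⟩ := h'.isClustering.exists_mem v
  obtain ⟨w, hw⟩ := h'.exists_isCommunity hD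
  exact ⟨D, hD, hv.subset_of_mem hw hβ hvD⟩

theorem CutC.clusters_eq (h : G.CutC α Ω) (h' : G.CutC α Ω') : clusters Ω = clusters Ω' :=
  h.isClustering.nested_antisymm h'.isClustering (h.nested h' le_rfl) (h'.nested h le_rfl)

theorem CutC.returns (h : G.CutC α Ω) : G.CutCReturns α (clusters Ω) :=
  ⟨⟨Ω, h⟩, fun _ h' => h'.clusters_eq h⟩

theorem CutC.lt_of_strictlyNested (h : G.CutC α Ω) (h' : G.CutC β Ω')
    (hs : StrictlyNested (clusters Ω) (clusters Ω')) : β < α := by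
  by_contra hle
  exact hs.2 (h.isClustering.nested_antisymm h'.isClustering hs.1 (h'.nested h (not_lt.1 hle)))

end CostGraph

namespace CostGraph

variable {V : Type u} [Fintype V] [DecidableEq V]
variable {G : CostGraph V} {α β αi αj : ℝ≥0} {Ω Ωi Ωj : Finset (Finset V × V)}
variable {𝒜 ℬ : Finset (Finset V)} {C C' S : Finset V}

/-! ### Intersections of cut-cost functions -/

/-- The point at which the cut-cost functions of `C` and `C'` take the same value, if `C'` is
smaller than `C`. -/
noncomputable def crossing (G : CostGraph V) (C C' : Finset V) : ℝ :=
  ((G.cutCost C' : ℝ) - G.cutCost C) / ((C.card : ℝ) - C'.card)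

theorem cutFun_eq_iff (h : C' ⊂ C) : G.cutFun C α = G.cutFun C' α ↔ (α : ℝ) = G.crossing C C' := by
  have hc : (0 : ℝ) < C.card - C'.card := sub_pos.2 (by exact_mod_cast Finset.card_lt_card h)
  unfold crossing cutFun
  rw [eq_div_iff hc.ne', ← NNReal.coe_inj]
  push_cast
  constructor <;> intro h <;> linarith

/-- The slope of a cut-cost function is the size of its set, so the function of the larger set is
the lower one to the left of the crossing. -/
theorem cutFun_lt_iff (h : C' ⊂ C) : G.cutFun C α < G.cutFun C' α ↔ (α : ℝ) < G.crossing C C' := by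
  have hc : (0 : ℝ) < C.card - C'.card := sub_pos.2 (by exact_mod_cast Finset.card_lt_card h)
  unfold crossing cutFun
  rw [lt_div_iff₀ hc, ← NNReal.coe_lt_coe]
  push_cast
  constructor <;> intro h <;> linarith

theorem mem_intersections {l : ℝ≥0} :
    l ∈ G.intersections 𝒜 C ↔ ∃ C' ∈ 𝒜, C' ⊂ C ∧ (l : ℝ) = G.crossing C C' := by
  refine exists_congr fun C' => and_congr_right fun _ => and_congr_right fun h => ?_
  exact cutFun_eq_iff h

/-- `crossing` is a real that may be negative and is then no intersection point; one above `l ≥ 0`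
would be nonnegative, hence an intersection point beyond the maximum. -/
theorem crossing_le_of_isGreatest {l : ℝ≥0} (hl : IsGreatest (G.intersections 𝒜 C) l)
    (hC' : C' ∈ 𝒜) (h : C' ⊂ C) : G.crossing C C' ≤ l := by
  by_contra! hlt
  have : (⟨G.crossing C C', l.2.trans hlt.le⟩ : ℝ≥0) ∈ G.intersections 𝒜 C :=
    mem_intersections.2 ⟨C', hC', h, rfl⟩
  have := NNReal.coe_le_coe.2 (hl.2 this)
  exact absurd hlt (not_lt.2 this)

theorem intersections_finite : (G.intersections 𝒜 C).Finite := by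
  refine (((𝒜 : Set (Finset V)).toFinite.image fun C' =>
    (G.crossing C C').toNNReal)).subset fun l hl => ?_
  obtain ⟨C', hC', -, h⟩ := mem_intersections.1 hl
  exact ⟨C', hC', by simp [← h]⟩

theorem CutC.ssubset_or_eq (hj : G.CutC β Ωj) (hn : Nested 𝒜 (clusters Ωj))
    (hC' : C' ∈ 𝒜) (hC : C ∈ clusters Ωj) {v : V} (hvC' : v ∈ C') (hvC : v ∈ C) :
    C' ⊂ C ∨ C' = C := by
  obtain ⟨D, hD, hCD⟩ := hn C' hC'
  rw [hj.isClustering.eq_of_mem hC hD hvC (hCD hvC')]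
  exact hCD.ssubset_or_eq

/-- At the parameter value of a cluster, the cluster lies below the child that contains its
representative. -/
theorem CutC.exists_lt_crossing (hi : IsClustering 𝒜) (hj : G.CutC β Ωj)
    (hn : Nested 𝒜 (clusters Ωj)) (hC : C ∈ clusters Ωj) (hCi : C ∉ 𝒜) :
    ∃ C' ∈ 𝒜, C' ⊂ C ∧ (β : ℝ) < G.crossing C C' := by
  obtain ⟨v, hv⟩ := hj.exists_isCommunity hC
  obtain ⟨C', hC', hvC'⟩ := hi.exists_mem v
  rcases hj.ssubset_or_eq hn hC' hC hvC' hv.mem with h | rfl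
  · exact ⟨C', hC', h, (cutFun_lt_iff h).1 (hv.lt_of_ssubset hvC' h)⟩
  · exact absurd hC' hCi

/-- `C` also contains the representative of `C'`, so it cannot be cheaper than the community `C'` at
`α`. -/
theorem CutC.crossing_le (hi : G.CutC α Ωi) (hC' : C' ∈ clusters Ωi) (h : C' ⊂ C) :
    G.crossing C C' ≤ α := by
  obtain ⟨v, hv⟩ := hi.exists_isCommunity hC'
  have := hv.le C (h.1 hv.mem)
  rwa [← not_lt, cutFun_lt_iff h, not_lt] at this

theorem CutC.exists_isGreatest (hi : IsClustering 𝒜) (hj : G.CutC β Ωj)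
    (hn : Nested 𝒜 (clusters Ωj)) (hC : C ∈ clusters Ωj) (hCi : C ∉ 𝒜) :
    ∃ l, IsGreatest (G.intersections 𝒜 C) l ∧ β < l := by
  obtain ⟨C', hC', h, hlt⟩ := CutC.exists_lt_crossing hi hj hn hC hCi
  have hmem : (⟨G.crossing C C', β.2.trans hlt.le⟩ : ℝ≥0) ∈ G.intersections 𝒜 C :=
    mem_intersections.2 ⟨C', hC', h, rfl⟩
  obtain ⟨l, hl, hmax⟩ := Set.exists_max_image _ id intersections_finite ⟨_, hmem⟩
  refine ⟨l, ⟨hl, hmax⟩, lt_of_lt_of_le ?_ (hmax _ hmem)⟩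
  exact NNReal.coe_lt_coe.1 hlt

/-- Clusters of a partition do not properly contain each other. Thus the minimum in `IsCandidate`,
taken over all of `ℬ`, effectively ranges over `ℬ \ 𝒜` only. -/
theorem intersections_eq_empty (hi : IsClustering 𝒜) (hC : C ∈ 𝒜) :
    G.intersections 𝒜 C = ∅ := by
  ext l
  simp only [mem_intersections, Set.mem_empty_iff_false, iff_false]
  rintro ⟨C', hC', h, -⟩
  obtain ⟨v, hv⟩ := hi.nonempty hC'
  exact h.ne (hi.eq_of_mem hC' hC hv (h.1 hv))

theorem IsGreatest.notMem_of_isClustering {l : ℝ≥0} (hi : IsClustering 𝒜)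
    (hl : IsGreatest (G.intersections 𝒜 C) l) : C ∉ 𝒜 := fun hC => by
  have := hl.1
  rw [intersections_eq_empty hi hC] at this
  exact this

theorem exists_mem_notMem (hi : IsClustering 𝒜) (hj : IsClustering ℬ)
    (h : StrictlyNested 𝒜 ℬ) : ∃ C ∈ ℬ, C ∉ 𝒜 := by
  by_contra! hall
  refine h.2 (hi.nested_antisymm hj h.1 fun C hC => ⟨C, hall C hC, subset_rfl⟩)

/-! ### The candidate value -/

theorem CutC.exists_isCandidate (hi : IsClustering 𝒜) (hj : G.CutC β Ωj)
    (h : StrictlyNested 𝒜 (clusters Ωj)) : ∃ l, G.IsCandidate 𝒜 (clusters Ωj) l := by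
  have hfin : {l | ∃ C ∈ clusters Ωj, IsGreatest (G.intersections 𝒜 C) l}.Finite := by
    have : {l | ∃ C ∈ clusters Ωj, IsGreatest (G.intersections 𝒜 C) l} ⊆
        ⋃ C ∈ clusters Ωj, G.intersections 𝒜 C := by
      rintro l ⟨C, hC, hl⟩
      exact Set.mem_biUnion hC hl.1
    exact (Set.Finite.biUnion (clusters Ωj).finite_toSet fun _ _ => intersections_finite).subset this
  obtain ⟨C, hC, hCi⟩ := exists_mem_notMem hi hj.isClustering h
  obtain ⟨l, hl, -⟩ := CutC.exists_isGreatest hi hj h.1 hC hCi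
  obtain ⟨a, ha, hmin⟩ := Set.exists_min_image _ id hfin ⟨l, C, hC, hl⟩
  exact ⟨a, ha, hmin⟩

theorem IsCandidate.gt (hi : IsClustering 𝒜) (hj : G.CutC β Ωj)
    (h : Nested 𝒜 (clusters Ωj)) (hα : G.IsCandidate 𝒜 (clusters Ωj) α) : β < α := by
  obtain ⟨C, hC, hl⟩ := hα.1
  obtain ⟨l, hl', hlt⟩ :=
    CutC.exists_isGreatest hi hj h hC (IsGreatest.notMem_of_isClustering hi hl)
  rwa [hl.unique hl']

theorem IsCandidate.le (hi : G.CutC αi Ωi) (hα : G.IsCandidate (clusters Ωi) ℬ α) : α ≤ αi := by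
  obtain ⟨C, -, hl⟩ := hα.1
  obtain ⟨C', hC', h, he⟩ := mem_intersections.1 hl.1
  exact NNReal.coe_le_coe.1 (he ▸ hi.crossing_le hC' h)

/-- If the upper clustering were returned, the parent attaining the minimum would lie strictly below
the child containing its representative at `α`, although all its crossings are at most `α`. -/
theorem IsCandidate.ne (hi : G.CutC αi Ωi)
    (h : Nested (clusters Ωi) (clusters Ωj))
    (hα : G.IsCandidate (clusters Ωi) (clusters Ωj) α) (hΩ : G.CutC α Ω) :
    clusters Ω ≠ clusters Ωj := by
  intro he
  obtain ⟨C, hC, hl⟩ := hα.1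
  obtain ⟨C', hC', hss, hlt⟩ := CutC.exists_lt_crossing hi.isClustering hΩ (he ▸ h) (he ▸ hC)
    (IsGreatest.notMem_of_isClustering hi.isClustering hl)
  exact absurd hlt (not_lt.2 (crossing_le_of_isGreatest hl hC' hss))

theorem IsCandidate.strictlyNested (hi : G.CutC αi Ωi) (hj : G.CutC αj Ωj)
    (h : Nested (clusters Ωi) (clusters Ωj))
    (hα : G.IsCandidate (clusters Ωi) (clusters Ωj) α) (hΩ : G.CutC α Ω) :
    Nested (clusters Ωi) (clusters Ω) ∧ StrictlyNested (clusters Ω) (clusters Ωj) :=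
  ⟨hi.nested hΩ (hα.le hi), hΩ.nested hj (hα.gt hi.isClustering hj h).le, hα.ne hi h hΩ⟩

/-- If CutC returns the lower clustering for the candidate value, then it returns the upper one
below the candidate value. -/
theorem IsCandidate.clusters_eq_of_lt (hi : G.CutC α Ωi) (hj : G.CutC αj Ωj)
    (h : Nested (clusters Ωi) (clusters Ωj))
    (hα : G.IsCandidate (clusters Ωi) (clusters Ωj) α) (hβ : αj ≤ β) (hβα : β < α)
    (hΩ : G.CutC β Ω) : clusters Ω = clusters Ωj := by
  have h₁ := hi.nested hΩ hβα.le
  have h₂ := hΩ.nested hj hβ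
  by_contra hne
  obtain ⟨C, hC, hCΩ⟩ := exists_mem_notMem hΩ.isClustering hj.isClustering ⟨h₂, hne⟩
  -- A cluster common to the lower and the upper clustering also belongs to every clustering nested
  -- between them.
  have hCi : C ∉ clusters Ωi := fun hCi => by
    obtain ⟨D, hD, hCD⟩ := h₁ C hCi
    obtain ⟨v, hv⟩ := hi.isClustering.nonempty hCi
    rcases hj.ssubset_or_eq h₂ hD hC (hCD hv) hv with hs | rfl
    · exact hs.2 hCD
    · exact hCΩ hD
  obtain ⟨l, hl, -⟩ := CutC.exists_isGreatest hi.isClustering hj h hC hCi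
  have hαl : α ≤ l := hα.2 ⟨C, hC, hl⟩
  obtain ⟨C', hC', hs, he⟩ := mem_intersections.1 hl.1
  -- The lower clustering is returned for `α` itself, so no crossing exceeds `α`, while minimality
  -- of the candidate gives the other inequality. Hence `C` ties with a child `C'` exactly at `α`.
  have hlα : l = α :=
    le_antisymm (NNReal.coe_le_coe.1 (he ▸ hi.crossing_le hC' hs)) hαl
  rw [hlα, ← cutFun_eq_iff hs] at he
  obtain ⟨v, hv⟩ := hi.exists_isCommunity hC'
  obtain ⟨D, hD, hCD⟩ := h₁ C' hC'
  have hDC : D ⊂ C :=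
    (hj.ssubset_or_eq h₂ hD hC (hCD hv.mem) (hs.1 hv.mem)).resolve_right
      fun hDC => hCΩ (hDC ▸ hD)
  -- `D` lies between `C'` and `C`. Being returned for `β`, it crosses `C` at or below `β`; but at
  -- `α` it costs at least as much as `C'`, hence as `C`, so it crosses `C` at or above `α`.
  have h3 : G.crossing C D ≤ β := hΩ.crossing_le hD hDC
  have h4 := hv.le D (hCD hv.mem)
  rw [← he] at h4
  rcases h4.lt_or_eq with h5 | h5
  · rw [cutFun_lt_iff hDC] at h5
    exact absurd (h5.trans_le h3) (not_lt.2 (NNReal.coe_le_coe.2 hβα.le))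
  · rw [cutFun_eq_iff hDC] at h5
    exact absurd (h5.le.trans h3) (not_le.2 (NNReal.coe_lt_coe.2 hβα))

/-- Any level strictly between would have a parameter in the range where the upper clustering is
already returned. -/
theorem IsCandidate.consecutive (hi : G.CutC α Ωi) (hj : G.CutC αj Ωj)
    (h : StrictlyNested (clusters Ωi) (clusters Ωj))
    (hα : G.IsCandidate (clusters Ωi) (clusters Ωj) α) :
    G.Consecutive (clusters Ωi) (clusters Ωj) := by
  refine ⟨⟨_, _, hi, rfl⟩, ⟨_, _, hj, rfl⟩, h, ?_⟩
  rintro _ ⟨γ, Ω, hΩ, rfl⟩ ⟨h₁, h₂⟩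
  exact h₂.2 (hα.clusters_eq_of_lt hi hj h.1 (hΩ.lt_of_strictlyNested hj h₂).le
    (hi.lt_of_strictlyNested hΩ h₁) hΩ)

theorem IsCandidate.isBreakpoint (hi : G.CutC α Ωi) (hj : G.CutC αj Ωj)
    (h : StrictlyNested (clusters Ωi) (clusters Ωj))
    (hα : G.IsCandidate (clusters Ωi) (clusters Ωj) α) :
    G.IsBreakpoint (clusters Ωi) (clusters Ωj) α := by
  refine ⟨hα.consecutive hi hj h, hi.returns, ?_⟩
  filter_upwards [Ioo_mem_nhdsLT (hα.gt hi.isClustering hj h.1)] with β hβ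
  obtain ⟨Ω, hΩ⟩ := G.exists_cutC β
  exact hα.clusters_eq_of_lt hi hj h.1 hβ.1.le hβ.2 hΩ ▸ hΩ.returns

end CostGraph

namespace RAM

/-! ### Verification of programs -/

/-- Started in `m`, the program `P` halts after at most `k` steps, with a memory that satisfies
`Q`. -/
def Reaches (P : Prog) (m : Mem) (k : ℕ) (Q : Mem → Prop) : Prop :=
  ∃ m' n, Exec P m m' n ∧ n ≤ k ∧ Q m'

namespace Reaches

variable {P P' : Prog} {m : Mem} {k l : ℕ} {Q R : Mem → Prop} {b : Test}

theorem mono (h : Reaches P m k Q) (hk : k ≤ l) (hQ : ∀ m', Q m' → R m') : Reaches P m l R := by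
  obtain ⟨m', n, he, hn, hq⟩ := h
  exact ⟨m', n, he, hn.trans hk, hQ _ hq⟩

theorem instr {i : Instr} (h : Q (i.run m)) : Reaches (.instr i) m 1 Q :=
  ⟨_, _, .instr i m, le_rfl, h⟩

theorem seq (h : Reaches P m k fun m' => Reaches P' m' l Q) : Reaches (.seq P P') m (k + l) Q := by
  obtain ⟨m₁, n₁, he₁, hn₁, m₂, n₂, he₂, hn₂, hq⟩ := h
  exact ⟨m₂, _, .seq _ _ _ _ _ _ _ he₁ he₂, by omega, hq⟩

theorem instr_seq {i : Instr} (h : Reaches P (i.run m) k Q) :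
    Reaches (.seq (.instr i) P) m (k + 1) Q := by
  rw [add_comm]
  exact seq (instr h)

theorem cond (h₁ : b.Holds m → Reaches P m k Q) (h₂ : ¬ b.Holds m → Reaches P' m k Q) :
    Reaches (.cond b P P') m (k + 1) Q := by
  by_cases hb : b.Holds m
  · obtain ⟨m', n, he, hn, hq⟩ := h₁ hb
    exact ⟨m', _, .condTrue _ _ _ _ _ _ hb he, by omega, hq⟩
  · obtain ⟨m', n, he, hn, hq⟩ := h₂ hb
    exact ⟨m', _, .condFalse _ _ _ _ _ _ hb he, by omega, hq⟩

/-- Induction on the number of remaining rounds. Each round pays one extra step for its test, and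
the last `+ 1` pays for the failing test. -/
theorem loop_natLt {x y N : ℕ} (I : ℕ → Mem → Prop)
    (hI : ∀ i m, I i m → m.nat x = i ∧ m.nat y = N)
    (hP : ∀ i m, i < N → I i m → Reaches P m k (I (i + 1))) (h : I 0 m) :
    Reaches (.loop (.natLt x y) P) m (N * (k + 1) + 1) (I N) := by
  have key : ∀ j i m, i + j = N → I i m →
      Reaches (.loop (.natLt x y) P) m (j * (k + 1) + 1) (I N) := by
    intro j
    induction j with
    | zero =>
      intro i m hij hm
      obtain rfl : i = N := hij
      refine ⟨m, _, .loopFalse _ _ _ ?_, by omega, hm⟩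
      simp [Test.Holds, hI _ _ hm]
    | succ j ih =>
      intro i m hij hm
      have hiN : i < N := by omega
      obtain ⟨m₁, n₁, he₁, hn₁, hm₁⟩ := hP i m hiN hm
      obtain ⟨m₂, n₂, he₂, hn₂, hm₂⟩ := ih (i + 1) m₁ (by omega) hm₁
      refine ⟨m₂, _, .loopTrue _ _ _ _ _ _ _ ?_ he₁ he₂, ?_, hm₂⟩
      · simpa [Test.Holds, hI _ _ hm] using hiN
      · rw [Nat.add_mul]; omega
  exact key N 0 m (Nat.zero_add N) h

end Reaches

/-! ### The program for the candidate value -/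

/-- Skip. -/
def skip : Prog := .instr (.natConst 9 0)

/-- Set the constants `0` and `1` and the result `0`. -/
def initProg (P : Prog) : Prog :=
  .seq (.instr (.natConst 3 1)) <| .seq (.instr (.natConst 2 0)) <|
  .seq (.instr (.realOfNat 6 2)) <| .seq (.instr (.realOfNat 0 2)) P

/-- Set the current maximum of each parent to `0`. -/
def clearProg : Prog :=
  .loop (.natLt 2 1) <| .seq (.instr (.realStore 2 2 6)) (.instr (.natAdd 2 2 3))

/-- Replace the entry of the array of maxima by real register `4` if this is greater. -/
def storeMaxProg : Prog :=
  .seq (.instr (.realLoad 5 2 5)) <| .cond (.realLt 5 4) (.instr (.realStore 2 5 4)) skip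

/-- For each child, look up its parent and update the maximum of the parent. -/
def maxProg : Prog :=
  .loop (.natLt 2 0) <|
    .seq (.instr (.natLoad 4 0 2)) <| .seq (.instr (.natLoad 5 5 4)) <|
    .seq (.instr (.natLoad 6 1 2)) <| .seq (.instr (.natLoad 7 4 5)) <|
    .seq (.cond (.natLt 6 7)
      (.seq (.instr (.natSub 8 7 6)) <| .seq (.instr (.realOfNat 3 8)) <|
        .seq (.instr (.realLoad 1 0 2)) <| .seq (.instr (.realLoad 2 1 5)) <|
        .seq (.instr (.realSub 4 1 2)) <| .seq (.instr (.realDiv 4 4 3)) storeMaxProg)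
      skip)
    (.instr (.natAdd 2 2 3))

/-- Compute the minimum of the positive maxima. -/
def minProg : Prog :=
  .loop (.natLt 2 1) <|
    .seq (.instr (.realLoad 5 2 2)) <|
    .seq (.cond (.realLt 6 5)
      (.cond (.realLt 6 0) (.cond (.realLt 5 0) (.instr (.realCopy 0 5)) skip)
        (.instr (.realCopy 0 5)))
      skip)
    (.instr (.natAdd 2 2 3))

/-- The program that computes the candidate value. -/
def candidateProg : Prog :=
  initProg <| .seq clearProg <| .seq (.instr (.natConst 2 0)) <| .seq maxProg <|
    .seq (.instr (.natConst 2 0)) minProg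

/-- The values that compete for the maximum of the parent at position `q`, among the children at
positions below `i`. -/
def competitors (m : Mem) (i q : ℕ) : Set ℝ :=
  {x | ∃ p < i, m.natArr 5 (m.natArr 0 p) = q ∧ m.natArr 1 p < m.natArr 4 q ∧
    x = (m.realArr 0 p - m.realArr 1 q) / ((m.natArr 4 q : ℝ) - m.natArr 1 p)}

/-- The input cells of `m` and `m'` agree, and the constants are set. -/
structure Agree (m m' : Mem) : Prop where
  nat0 : m'.nat 0 = m.nat 0
  nat1 : m'.nat 1 = m.nat 1
  nat3 : m'.nat 3 = 1
  real6 : m'.real 6 = 0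
  natArr : m'.natArr = m.natArr
  realArr0 : m'.realArr 0 = m.realArr 0
  realArr1 : m'.realArr 1 = m.realArr 1

/-- `x` is the maximum of `0` and the elements of `W`. -/
def IsPosMax (W : Set ℝ) (x : ℝ) : Prop :=
  0 ≤ x ∧ (∀ y ∈ W, y ≤ x) ∧ (x = 0 ∨ x ∈ W)

/-- `x` is the minimum of the positive values of `f` at arguments below `i`, or `0` if there are
none. -/
def IsPosMin (f : ℕ → ℝ) (i : ℕ) (x : ℝ) : Prop :=
  (∀ q < i, 0 < f q → 0 < x ∧ x ≤ f q) ∧ (x = 0 ∨ ∃ q < i, 0 < f q ∧ x = f q)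

/-- Throughout the program natural register `2` is the loop counter, `3` holds the constant `1`,
real register `6` holds `0`, real register `0` the result, and real array `2` the running maxima.
That array is cleared because the input leaves it arbitrary. -/
theorem clearProg_reaches {m m₀ : Mem} (h : Agree m₀ m) (hp : m.nat 2 = 0) (hr : m.real 0 = 0) :
    Reaches clearProg m (m₀.nat 1 * 3 + 1) fun m' =>
      Agree m₀ m' ∧ m'.real 0 = 0 ∧ ∀ q < m₀.nat 1, m'.realArr 2 q = 0 := by
  refine (Reaches.loop_natLt (k := 2) (N := m₀.nat 1) (fun i m' => m'.nat 2 = i ∧ Agree m₀ m' ∧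
    m'.real 0 = 0 ∧ ∀ q < i, m'.realArr 2 q = 0) ?_ ?_ ?_).mono le_rfl ?_
  · rintro i m' ⟨h1, h2, -⟩
    exact ⟨h1, h2.nat1⟩
  · rintro i m' hi ⟨h1, ⟨a1, a2, a3, a4, a5, a6, a7⟩, h3, h4⟩
    refine .instr_seq (.instr ⟨?_, ⟨?_, ?_, ?_, ?_, ?_, ?_, ?_⟩, ?_, ?_⟩) <;>
      simp_all [Instr.run, Function.update_apply]
    intro q hq hne
    exact h4 q (by omega)
  · exact ⟨hp, h, hr, by simp⟩
  · exact fun m' h => h.2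

theorem storeMaxProg_reaches {m m₀ : Mem} (h : Agree m₀ m) :
    Reaches storeMaxProg m 3 fun m' => Agree m₀ m' ∧ m'.nat 2 = m.nat 2 ∧ m'.real 0 = m.real 0 ∧
      m'.realArr 2 = Function.update (m.realArr 2) (m.nat 5)
        (max (m.realArr 2 (m.nat 5)) (m.real 4)) := by
  obtain ⟨a1, a2, a3, a4, a5, a6, a7⟩ := h
  refine .instr_seq (.cond (k := 1) (fun hb => .instr ?_) fun hb => .instr ?_)
  · have hb' : m.realArr 2 (m.nat 5) < m.real 4 := by
      simpa [Test.Holds, Instr.run, Function.update_apply] using hb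
    refine ⟨⟨?_, ?_, ?_, ?_, ?_, ?_, ?_⟩, ?_, ?_, ?_⟩ <;>
      simp_all [Instr.run]
    rw [max_eq_right hb'.le]
  · have hb' : m.real 4 ≤ m.realArr 2 (m.nat 5) := by
      simpa [Test.Holds, Instr.run, Function.update_apply] using hb
    refine ⟨⟨?_, ?_, ?_, ?_, ?_, ?_, ?_⟩, ?_, ?_, ?_⟩ <;>
      simp_all [Instr.run]

theorem IsPosMax.insert {W : Set ℝ} {x : ℝ} (h : IsPosMax W x) (y : ℝ) :
    IsPosMax (insert y W) (max x y) := by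
  obtain ⟨h1, h2, h3⟩ := h
  refine ⟨h1.trans (le_max_left _ _), ?_, ?_⟩
  · rintro z (rfl | hz)
    · exact le_max_right _ _
    · exact (h2 z hz).trans (le_max_left _ _)
  · rcases max_choice x y with hm | hm <;> rw [hm]
    · exact h3.imp id Or.inr
    · exact Or.inr (Or.inl rfl)

theorem competitors_succ_of_not {m : Mem} {i q : ℕ}
    (h : ¬ (m.natArr 5 (m.natArr 0 i) = q ∧ m.natArr 1 i < m.natArr 4 q)) :
    competitors m (i + 1) q = competitors m i q := by
  ext x
  constructor
  · rintro ⟨p, hp, h1, h2, h3⟩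
    rcases Nat.lt_succ_iff_lt_or_eq.1 hp with hp | rfl
    · exact ⟨p, hp, h1, h2, h3⟩
    · exact absurd ⟨h1, h2⟩ h
  · rintro ⟨p, hp, h1⟩
    exact ⟨p, by omega, h1⟩

theorem competitors_succ {m : Mem} {i q : ℕ} (h₁ : m.natArr 5 (m.natArr 0 i) = q)
    (h₂ : m.natArr 1 i < m.natArr 4 q) :
    competitors m (i + 1) q = insert ((m.realArr 0 i - m.realArr 1 q) /
      ((m.natArr 4 q : ℝ) - m.natArr 1 i)) (competitors m i q) := by
  ext x
  constructor
  · rintro ⟨p, hp, h1, h2, h3⟩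
    rcases Nat.lt_succ_iff_lt_or_eq.1 hp with hp | rfl
    · exact Or.inr ⟨p, hp, h1, h2, h3⟩
    · exact Or.inl h3
  · rintro (rfl | ⟨p, hp, h1⟩)
    · exact ⟨i, by omega, h₁, h₂, rfl⟩
    · exact ⟨p, by omega, h1⟩

/-- The size test singles out proper children, which also keeps the divisor positive. Only the entry
of the parent of the current child can change in a round. -/
theorem maxProg_reaches {m m₀ : Mem} (h : Agree m₀ m) (hp : m.nat 2 = 0) (hr : m.real 0 = 0)
    (hmax : ∀ q < m₀.nat 1, m.realArr 2 q = 0) :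
    Reaches maxProg m (m₀.nat 0 * 16 + 1) fun m' => Agree m₀ m' ∧ m'.real 0 = 0 ∧
      ∀ q < m₀.nat 1, IsPosMax (competitors m₀ (m₀.nat 0) q) (m'.realArr 2 q) := by
  refine (Reaches.loop_natLt (k := 15) (N := m₀.nat 0) (fun i m' => m'.nat 2 = i ∧ Agree m₀ m' ∧
    m'.real 0 = 0 ∧ ∀ q < m₀.nat 1, IsPosMax (competitors m₀ i q) (m'.realArr 2 q))
    ?_ ?_ ?_).mono le_rfl ?_
  · rintro i m' ⟨h1, h2, -⟩
    exact ⟨h1, h2.nat0⟩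
  · rintro i m' hi ⟨h1, ⟨a1, a2, a3, a4, a5, a6, a7⟩, h3, h4⟩
    refine .instr_seq <| .instr_seq <| .instr_seq <| .instr_seq <|
      .seq (k := 10) (l := 1) (.mono (k := 10) (Q := fun m₁ => Agree m₀ m₁ ∧ m₁.nat 2 = i ∧
        m₁.real 0 = 0 ∧ ∀ q < m₀.nat 1, IsPosMax (competitors m₀ (i + 1) q) (m₁.realArr 2 q))
        (.cond (k := 9) (fun hb => ?_) fun hb => ?_) le_rfl ?_)
    · have hb' : m₀.natArr 1 i < m₀.natArr 4 (m₀.natArr 5 (m₀.natArr 0 i)) := by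
        simpa [Test.Holds, Instr.run, Function.update_apply, a5, h1] using hb
      refine .instr_seq <| .instr_seq <| .instr_seq <| .instr_seq <| .instr_seq <| .instr_seq <|
        .mono (storeMaxProg_reaches (m₀ := m₀) ?_) le_rfl ?_
      · constructor <;> simp [Instr.run, *]
      · rintro m₁ ⟨hA, h5, h6, h7⟩
        refine ⟨hA, ?_, ?_, fun q hq => ?_⟩
        · simp [h5, Instr.run, h1]
        · simp [h6, Instr.run, h3]
        · rw [h7]
          simp only [Instr.run, Function.update_apply]
          simp only [a5, a6, a7, h1, ↓reduceIte, Nat.reduceEqDiff]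
          -- The truncated subtraction of sizes is exact because the test has just been passed.
          rw [Nat.cast_sub hb'.le]
          split_ifs with hqe
          · subst hqe
            rw [competitors_succ rfl hb']
            exact (h4 _ hq).insert _
          · rw [competitors_succ_of_not fun hc => hqe hc.1.symm]
            exact h4 q hq
    · refine .mono (k := 1) (.instr ?_) (by omega) fun _ => id
      have hb' : ¬ m₀.natArr 1 i < m₀.natArr 4 (m₀.natArr 5 (m₀.natArr 0 i)) := by
        simpa [Test.Holds, Instr.run, Function.update_apply, a5, h1] using hb
      refine ⟨?_, ?_, ?_, fun q hq => ?_⟩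
      · constructor <;> simp [Instr.run, *]
      · simp [Instr.run, h1]
      · simp [Instr.run, h3]
      · rw [competitors_succ_of_not]
        · exact h4 q hq
        · rintro ⟨rfl, hlt⟩
          exact hb' hlt
    · rintro m₁ ⟨⟨a1, a2, a3, a4, a5, a6, a7⟩, h5, h6, h7⟩
      refine .instr ⟨?_, ?_, ?_, ?_⟩
      · simp [Instr.run, a3, h5]
      · constructor <;> simp [Instr.run, *]
      · simp [Instr.run, h6]
      · exact h7
  · refine ⟨hp, h, hr, fun q hq => ⟨(hmax q hq).ge, ?_, Or.inl (hmax q hq)⟩⟩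
    rintro y ⟨p, hp, -⟩
    omega
  · exact fun m' h => h.2

theorem IsPosMin.succ_of_not {f : ℕ → ℝ} {i : ℕ} {x : ℝ} (h : IsPosMin f i x) (hi : ¬ 0 < f i) :
    IsPosMin f (i + 1) x := by
  refine ⟨fun q hq hfq => ?_, h.2.imp id fun ⟨q, hq, h'⟩ => ⟨q, by omega, h'⟩⟩
  rcases Nat.lt_succ_iff_lt_or_eq.1 hq with hq | rfl
  · exact h.1 q hq hfq
  · exact absurd hfq hi

theorem IsPosMin.succ_of_le {f : ℕ → ℝ} {i : ℕ} {x : ℝ} (h : IsPosMin f i x) (hx : 0 < x)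
    (hle : x ≤ f i) : IsPosMin f (i + 1) x := by
  refine ⟨fun q hq hfq => ?_, h.2.imp id fun ⟨q, hq, h'⟩ => ⟨q, by omega, h'⟩⟩
  rcases Nat.lt_succ_iff_lt_or_eq.1 hq with hq | rfl
  · exact h.1 q hq hfq
  · exact ⟨hx, hle⟩

theorem IsPosMin.succ_self {f : ℕ → ℝ} {i : ℕ} {x : ℝ} (h : IsPosMin f i x) (hi : 0 < f i)
    (hle : 0 < x → f i ≤ x) : IsPosMin f (i + 1) (f i) := by
  refine ⟨fun q hq hfq => ⟨hi, ?_⟩, Or.inr ⟨i, by omega, hi, rfl⟩⟩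
  rcases Nat.lt_succ_iff_lt_or_eq.1 hq with hq | rfl
  · obtain ⟨h1, h2⟩ := h.1 q hq hfq
    exact (hle h1).trans h2
  · exact le_rfl

/-- The value `0` in the result register means that no positive maximum has been seen yet; this is
safe since only positive values are ever stored there. -/
theorem minProg_reaches {m : Mem} (h6 : m.real 6 = 0) (h3 : m.nat 3 = 1) (hp : m.nat 2 = 0)
    (hr : m.real 0 = 0) :
    Reaches minProg m (m.nat 1 * 7 + 1) fun m' => IsPosMin (m.realArr 2) (m.nat 1) (m'.real 0) := by
  refine (Reaches.loop_natLt (k := 6) (N := m.nat 1) (fun i m' => m'.nat 2 = i ∧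
    (m'.nat 1 = m.nat 1 ∧ m'.nat 3 = 1 ∧ m'.real 6 = 0 ∧ m'.realArr = m.realArr) ∧
    IsPosMin (m.realArr 2) i (m'.real 0)) ?_ ?_ ?_).mono le_rfl ?_
  · rintro i m' ⟨h1, h2, -⟩
    exact ⟨h1, h2.1⟩
  · rintro i m' hi ⟨h1, ⟨a1, a2, a3, a4⟩, hm⟩
    refine .instr_seq <|
      .seq (k := 4) (l := 1) (.mono (k := 4) (Q := fun m₁ => (m₁.nat 1 = m.nat 1 ∧ m₁.nat 3 = 1 ∧
        m₁.real 6 = 0 ∧ m₁.realArr = m.realArr) ∧ m₁.nat 2 = i ∧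
        IsPosMin (m.realArr 2) (i + 1) (m₁.real 0))
        (.cond (k := 3) (fun hb => .cond (k := 2) (fun hb₁ => .cond (k := 1) (fun hb₂ => .instr ?_)
          fun hb₂ => .instr ?_) fun hb₁ => .mono (k := 1) (.instr ?_) (by omega) fun _ => id)
          fun hb => .mono (k := 1) (.instr ?_) (by omega) fun _ => id) le_rfl ?_)
    all_goals try simp [Test.Holds, Instr.run, a3, a4, h1] at hb
    all_goals try simp [Test.Holds, Instr.run, a3, a4, h1] at hb₁
    all_goals try simp [Test.Holds, Instr.run, a4, h1] at hb₂
    · refine ⟨?_, ?_, ?_⟩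
      · simp [Instr.run, *]
      · simp [Instr.run, h1]
      · simpa [Instr.run, Function.update_apply, a4, h1] using hm.succ_self hb fun _ => hb₂.le
    · refine ⟨?_, ?_, ?_⟩
      · simp [Instr.run, *]
      · simp [Instr.run, h1]
      · simpa [Instr.run, Function.update_apply] using hm.succ_of_le hb₁ hb₂
    · refine ⟨?_, ?_, ?_⟩
      · simp [Instr.run, *]
      · simp [Instr.run, h1]
      · simpa [Instr.run, Function.update_apply, a4, h1] using
          hm.succ_self hb fun h0 => absurd h0 (not_lt.2 hb₁)
    · refine ⟨?_, ?_, ?_⟩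
      · simp [Instr.run, *]
      · simp [Instr.run, h1]
      · simpa [Instr.run, Function.update_apply] using hm.succ_of_not (not_lt.2 hb)
    · rintro m₁ ⟨⟨a1, a2, a3, a4⟩, h5, h7⟩
      refine .instr ⟨?_, ?_, ?_⟩
      · simp [Instr.run, a2, h5]
      · simp [Instr.run, *]
      · exact h7
  · exact ⟨hp, ⟨rfl, h3, h6, rfl⟩, by simp, Or.inl hr⟩
  · exact fun m' h => h.2.2

/-- The program computes the minimum, over the parents with at least one competitor, of the
maximal competitor. -/
theorem candidateProg_reaches (m : Mem) {a : ℝ} (ha : 0 < a)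
    (hle : ∀ q < m.nat 1, (competitors m (m.nat 0) q).Nonempty →
      ∃ y ∈ competitors m (m.nat 0) q, a ≤ y)
    (hmem : ∃ q < m.nat 1, IsGreatest (competitors m (m.nat 0) q) a) :
    Reaches candidateProg m (m.nat 0 * 16 + m.nat 1 * 10 + 9) fun m' => m'.real 0 = a := by
  have key : ∀ f : ℕ → ℝ, (∀ q < m.nat 1, IsPosMax (competitors m (m.nat 0) q) (f q)) →
      ∀ x, IsPosMin f (m.nat 1) x → x = a := by
    rintro f hf x ⟨hx1, hx2⟩
    obtain ⟨q, hq, hqa⟩ := hmem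
    obtain ⟨f1, f2, f3⟩ := hf q hq
    have hfq : f q = a := le_antisymm (f3.elim (fun h => h ▸ ha.le) fun h => hqa.2 h) (f2 a hqa.1)
    obtain ⟨hx, hxa⟩ := hx1 q hq (hfq ▸ ha)
    refine le_antisymm (hfq ▸ hxa) ?_
    obtain ⟨q', hq', hpos, rfl⟩ := hx2.resolve_left hx.ne'
    obtain ⟨g1, g2, g3⟩ := hf q' hq'
    obtain ⟨y, hy, hay⟩ := hle q' hq' ⟨_, g3.resolve_left hpos.ne'⟩
    exact hay.trans (g2 y hy)
  -- The constant `9` consists of four initial instructions, two resets of the counter and three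
  -- failing loop tests.
  refine .mono (k := (m.nat 1 * 3 + 1) + ((m.nat 0 * 16 + 1) + ((m.nat 1 * 7 + 1) + 1) + 1)
    + 1 + 1 + 1 + 1) (.instr_seq <| .instr_seq <| .instr_seq <| .instr_seq <|
      .seq <| .mono (clearProg_reaches (m₀ := m) ?_ ?_ ?_) le_rfl ?_) (by omega) fun _ => id
  · constructor <;> simp [Instr.run]
  · simp [Instr.run]
  · simp [Instr.run]
  rintro m₁ ⟨hA₁, hr₁, hz₁⟩
  refine .instr_seq <| .seq <| .mono (maxProg_reaches (m₀ := m) ?_ ?_ hr₁ hz₁) le_rfl ?_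
  · obtain ⟨a1, a2, a3, a4, a5, a6, a7⟩ := hA₁
    constructor <;> simp [Instr.run, *]
  · simp [Instr.run]
  rintro m₂ ⟨⟨a1, a2, a3, a4, a5, a6, a7⟩, hr₂, hz₂⟩
  refine .instr_seq <| .mono (minProg_reaches ?_ ?_ ?_ ?_) (le_of_eq ?_) fun m₃ hm₃ => ?_
  · exact a4
  · simpa [Instr.run] using a3
  · simp [Instr.run]
  · exact hr₂
  · simp [Instr.run, a2]
  · refine key _ hz₂ _ ?_
    simpa [Instr.run, a2] using hm₃

end RAM

namespace CostGraph

variable {V : Type u} [Fintype V] [DecidableEq V]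
variable {G : CostGraph V} {α αi αj : ℝ≥0} {Ω Ωi Ωj : Finset (Finset V × V)}

/-! ### Computation of the candidate value -/

/-- The parent of a child is found by looking up the child's representative, which lies in the child
and hence in the parent. Since the child is contained in this parent, comparing sizes decides proper
containment. -/
theorem mem_competitors_iff (hi : G.CutC αi Ωi) (hj : G.CutC αj Ωj)
    (h : Nested (clusters Ωi) (clusters Ωj)) {m : RAM.Mem} (hm : RAM.IsInput G Ωi Ωj m) :
    ∃ list : Fin Ωj.card ≃ {q // q ∈ Ωj}, ∀ q : Fin Ωj.card, ∀ x : ℝ,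
      x ∈ RAM.competitors m Ωi.card q ↔
        ∃ C' ∈ clusters Ωi, C' ⊂ (list q).1.1 ∧ x = G.crossing (list q).1.1 C' := by
  obtain ⟨num, ⟨-, li, hli⟩, -, lj, hlj⟩ := hm
  refine ⟨lj, fun q x => ⟨?_, ?_⟩⟩
  · rintro ⟨p, hp, h1, h2, rfl⟩
    obtain ⟨p1, p2, p3, -⟩ := hli ⟨p, hp⟩
    obtain ⟨-, q2, q3, -⟩ := hlj q
    set c := (li ⟨p, hp⟩).1 with hc
    have hci : c ∈ Ωi := (li ⟨p, hp⟩).2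
    have hmem : c.2 ∈ c.1 := (hi.isPartialOutput.community c hci).mem
    have hcc : c.1 ∈ clusters Ωi := mem_clusters.2 ⟨c.2, hci⟩
    obtain ⟨d, hd, hcd⟩ := (hj.isPartialOutput.notMem_iff c.2).1 (Finset.notMem_empty _)
    obtain ⟨q', hq'⟩ := lj.surjective ⟨d, hd⟩
    have hpos := (hlj q').2.2.2 c.2 (by rw [hq']; exact hcd)
    dsimp only at p1 p2 p3
    rw [p1] at h1
    have hqq : q = q' := Fin.ext (h1.symm.trans hpos)
    subst hqq
    rw [p2, q2] at h2 ⊢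
    rw [p3, q3]
    refine ⟨c.1, hcc, ?_, rfl⟩
    refine (hj.ssubset_or_eq h hcc (mem_clusters.2 ⟨d.2, hd⟩) hmem hcd).elim (fun hs => ?_)
      fun he => ?_
    · rw [hq']; exact hs
    · rw [hq', he] at h2
      exact absurd h2 (lt_irrefl _)
  · rintro ⟨C', hC', hs, rfl⟩
    obtain ⟨v, hv⟩ := mem_clusters.1 hC'
    obtain ⟨p, hp⟩ := li.surjective ⟨_, hv⟩
    obtain ⟨p1, p2, p3, -⟩ := hli p
    obtain ⟨-, q2, q3, q4⟩ := hlj q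
    rw [hp] at p1 p2 p3
    have hmem : v ∈ C' := (hi.isPartialOutput.community _ hv).mem
    refine ⟨p, p.2, ?_, ?_, ?_⟩
    · rw [p1]; exact q4 v (hs.1 hmem)
    · rw [p2, q2]; exact Finset.card_lt_card hs
    · rw [p2, q2, p3, q3]; rfl

theorem IsCandidate.reaches (hi : G.CutC αi Ωi) (hj : G.CutC αj Ωj)
    (h : Nested (clusters Ωi) (clusters Ωj))
    (hα : G.IsCandidate (clusters Ωi) (clusters Ωj) α) {m : RAM.Mem}
    (hm : RAM.IsInput G Ωi Ωj m) :
    ∃ (m' : RAM.Mem) (n : ℕ), RAM.Exec RAM.candidateProg m m' n ∧ n ≤ 35 * Ωi.card ∧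
      m'.real 0 = α := by
  obtain ⟨lj, hlj⟩ := mem_competitors_iff hi hj h hm
  obtain ⟨-, ⟨hi0, -⟩, hj0, -⟩ := hm
  have hpos : 0 < Ωi.card := by
    obtain ⟨C, -, hl⟩ := hα.1
    obtain ⟨C', hC', -⟩ := hl.1
    obtain ⟨v, hv⟩ := mem_clusters.1 hC'
    exact Finset.card_pos.2 ⟨_, hv⟩
  have hle : Ωj.card ≤ Ωi.card := by
    rw [← hi.card_clusters, ← hj.card_clusters]
    exact hi.isClustering.card_le hj.isClustering h
  have hlt := hα.gt hi.isClustering hj h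
  -- The constant is `35 = 16 + 10 + 9`: there are at most as many parents as children, and at least
  -- one child to absorb the additive `9`.
  refine (RAM.candidateProg_reaches m (a := α) ?_ ?_ ?_).mono (by omega) fun _ => id
  · exact NNReal.coe_pos.2 (hlt.trans_le' zero_le)
  · rw [hi0, hj0]
    rintro q hq ⟨x, hx⟩
    obtain ⟨C', hC', hs, -⟩ := (hlj ⟨q, hq⟩ x).1 hx
    have hC : (lj ⟨q, hq⟩).1.1 ∈ clusters Ωj := mem_clusters.2 ⟨_, (lj ⟨q, hq⟩).2⟩
    have hCi : (lj ⟨q, hq⟩).1.1 ∉ clusters Ωi := fun hCi => by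
      obtain ⟨v, hv⟩ := hi.isClustering.nonempty hC'
      exact hs.ne (hi.isClustering.eq_of_mem hC' hCi hv (hs.1 hv))
    obtain ⟨l, hl, -⟩ := CutC.exists_isGreatest hi.isClustering hj h hC hCi
    exact ⟨l, (hlj ⟨q, hq⟩ l).2 (mem_intersections.1 hl.1),
      NNReal.coe_le_coe.2 (hα.2 ⟨_, hC, hl⟩)⟩
  · rw [hi0, hj0]
    obtain ⟨C, hC, hl⟩ := hα.1
    obtain ⟨v, hv⟩ := mem_clusters.1 hC
    obtain ⟨q, hq⟩ := lj.surjective ⟨_, hv⟩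
    have hqC : (lj q).1.1 = C := by rw [hq]
    refine ⟨q, q.2, (hlj q _).2 (hqC ▸ mem_intersections.1 hl.1), fun x hx => ?_⟩
    obtain ⟨C', hC', hs, rfl⟩ := (hlj q x).1 hx
    rw [hqC] at hs ⊢
    exact crossing_le_of_isGreatest hl hC' hs

/-! ### The trivial clusterings -/

theorem IsCommunity.unique {v : V} {A B : Finset V} (hA : G.IsCommunity α v A)
    (hB : G.IsCommunity α v B) : A = B :=
  (hA.subset_of_mem hB le_rfl hB.mem).antisymm (hB.subset_of_mem hA le_rfl hA.mem)

/-- Shrinking `S` to `{v}` cuts at most the edges from `v` to the other vertices of `S`, and each of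
these costs no more than the saved edge to `t`. -/
theorem isCommunity_singleton (G : CostGraph V) (v : V) : G.IsCommunity G.maxCost v {v} := by
  refine ⟨by simp, fun S hS => ?_, fun S hS _ => ?_⟩
  · have h1 : G.cutCost {v} ≤ G.cutCost S + (S.erase v).card * G.maxCost := by
      have hsub : ({v} : Finset V)ᶜ ⊆ Sᶜ ∪ S.erase v := by
        intro w hw
        by_cases hwS : w ∈ S <;> simp_all
      calc G.cutCost {v} = ∑ w ∈ ({v} : Finset V)ᶜ, G.cost v w := by simp [cutCost]
        _ ≤ ∑ w ∈ Sᶜ ∪ S.erase v, G.cost v w := Finset.sum_le_sum_of_subset hsub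
        _ = ∑ w ∈ Sᶜ, G.cost v w + ∑ w ∈ S.erase v, G.cost v w :=
            Finset.sum_union (Finset.disjoint_left.2 fun w hw hw' =>
              Finset.mem_compl.1 hw (Finset.mem_of_mem_erase hw'))
        _ ≤ G.cutCost S + (S.erase v).card * G.maxCost := by
            refine add_le_add ?_ ?_
            · exact Finset.single_le_sum (f := fun v => ∑ w ∈ Sᶜ, G.cost v w)
                (fun _ _ => zero_le) hS
            · rw [← nsmul_eq_mul]
              exact Finset.sum_le_card_nsmul _ _ _ fun w _ =>
                le_ciSup (f := fun e : V × V => G.cost e.1 e.2) (Set.finite_range _).bddAbove (v, w)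
    have h2 : (S.card : ℝ≥0) = (S.erase v).card + 1 := by
      exact_mod_cast (Finset.card_erase_add_one hS).symm
    unfold cutFun
    rw [h2, add_mul, ← add_assoc]
    simpa using h1
  · simpa using Finset.card_pos.2 ⟨v, hS⟩

theorem CutC.clusters_eq_singletons (h : G.CutC G.maxCost Ω) : clusters Ω = G.singletons := by
  have key : ∀ C ∈ clusters Ω, ∃ v, C = {v} := fun C hC => by
    obtain ⟨v, hv⟩ := h.exists_isCommunity hC
    exact ⟨v, hv.unique (G.isCommunity_singleton v)⟩
  ext C
  simp only [singletons, Finset.mem_image, Finset.mem_univ, true_and]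
  constructor
  · intro hC
    obtain ⟨v, rfl⟩ := key C hC
    exact ⟨v, rfl⟩
  · rintro ⟨v, rfl⟩
    obtain ⟨C, hC, hvC⟩ := h.isClustering.exists_mem v
    obtain ⟨w, rfl⟩ := key C hC
    rwa [Finset.mem_singleton.1 hvC]

open Classical in
-- At parameter `0` the component of `v` has cut cost `0`, so the community does too. A set of cut
-- cost `0` is closed under adjacency and contains the component; minimal cardinality gives
-- equality.
theorem IsCommunity.eq_component {v : V} {C : Finset V} (h : G.IsCommunity 0 v C) :
    C = Finset.univ.filter fun w => G.graph.Reachable v w := by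
  set D := Finset.univ.filter fun w => G.graph.Reachable v w with hD
  have hvD : v ∈ D := by simp [hD]
  have hD0 : G.cutFun D 0 = 0 := by
    simp only [cutFun, mul_zero, add_zero, cutCost]
    refine Finset.sum_eq_zero fun x hx => Finset.sum_eq_zero fun y hy => ?_
    by_contra hne
    simp only [hD, Finset.mem_filter, Finset.mem_univ, true_and, Finset.mem_compl] at hx hy
    exact hy (hx.trans (SimpleGraph.Adj.reachable (G := G.graph) (pos_iff_ne_zero.2 hne)))
  have hC0 : G.cutFun C 0 = 0 := le_antisymm ((h.le D hvD).trans hD0.le) zero_le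
  have hclosed : ∀ x ∈ C, ∀ y, G.graph.Adj x y → y ∈ C := by
    intro x hx y hxy
    by_contra hy
    have hxy' : 0 < G.cost x y := hxy
    simp only [cutFun, mul_zero, add_zero, cutCost] at hC0
    have := Finset.sum_eq_zero_iff.1 (Finset.sum_eq_zero_iff.1 hC0 x hx) y (by simpa using hy)
    exact hxy'.ne' this
  have hsub : D ⊆ C := by
    intro w hw
    obtain ⟨p⟩ : G.graph.Reachable v w := by simpa [hD] using hw
    have : ∀ x y, G.graph.Walk x y → x ∈ C → y ∈ C := by
      intro x y p
      induction p with
      | nil => exact id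
      | cons hxy _ ih => exact fun hx => ih (hclosed _ hx _ hxy)
    exact this v w p h.mem
  exact (Finset.eq_of_subset_of_card_le hsub (h.card_le D hvD (hD0.trans hC0.symm))).symm

theorem CutC.clusters_eq_components (h : G.CutC 0 Ω) : clusters Ω = G.components := by
  classical
  ext C
  simp only [components, Finset.mem_image, Finset.mem_univ, true_and]
  constructor
  · intro hC
    obtain ⟨v, hv⟩ := h.exists_isCommunity hC
    exact ⟨v, by convert hv.eq_component.symm⟩
  · rintro ⟨v, rfl⟩
    obtain ⟨C, hC, hvC⟩ := h.isClustering.exists_mem v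
    obtain ⟨w, hw⟩ := h.exists_isCommunity hC
    obtain ⟨D, hD⟩ := G.exists_isCommunity 0 v
    have hDC := hD.subset_of_mem hw le_rfl hvC
    have hwv : G.graph.Reachable w v := by
      have := hw.eq_component ▸ hvC
      simpa using this
    have hwD : w ∈ D := by
      rw [hD.eq_component]
      simpa using hwv.symm
    have hCD := hw.subset_of_mem hD le_rfl hwD
    have : C = D := hCD.antisymm hDC
    rw [this, hD.eq_component] at hC
    convert hC

/-! ### The parametric search -/

/-- `L` is a level, with a parameter value for which CutC returns it. -/
def IsLevel (G : CostGraph V) (L : ℝ≥0 × Finset (Finset V)) : Prop :=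
  ∃ Ω, G.CutC L.1 Ω ∧ clusters Ω = L.2

theorem IsLevel.isClustering {L : ℝ≥0 × Finset (Finset V)} (h : G.IsLevel L) :
    IsClustering L.2 := by
  obtain ⟨Ω, hΩ, he⟩ := h
  exact he ▸ hΩ.isClustering

theorem IsLevel.mem_cutClusterings {L : ℝ≥0 × Finset (Finset V)} (h : G.IsLevel L) :
    L.2 ∈ G.cutClusterings := by
  obtain ⟨Ω, hΩ, he⟩ := h
  exact ⟨_, Ω, hΩ, he⟩

theorem isLevel_singletons (G : CostGraph V) : G.IsLevel (G.maxCost, G.singletons) := by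
  obtain ⟨Ω, hΩ⟩ := G.exists_cutC G.maxCost
  exact ⟨Ω, hΩ, hΩ.clusters_eq_singletons⟩

theorem isLevel_components (G : CostGraph V) : G.IsLevel (0, G.components) := by
  obtain ⟨Ω, hΩ⟩ := G.exists_cutC 0
  exact ⟨Ω, hΩ, hΩ.clusters_eq_components⟩

theorem nested_or_nested {𝒜 ℬ : Finset (Finset V)} (hA : 𝒜 ∈ G.cutClusterings)
    (hB : ℬ ∈ G.cutClusterings) : Nested 𝒜 ℬ ∨ Nested ℬ 𝒜 := by
  obtain ⟨α, Ω, hΩ, rfl⟩ := hA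
  obtain ⟨β, Ω', hΩ', rfl⟩ := hB
  rcases le_total β α with h | h
  · exact Or.inl (hΩ.nested hΩ' h)
  · exact Or.inr (hΩ'.nested hΩ h)

theorem nested_of_mem_cutClusterings {𝒜 : Finset (Finset V)} (hA : 𝒜 ∈ G.cutClusterings) :
    Nested G.singletons 𝒜 ∧ Nested 𝒜 G.components := by
  obtain ⟨α, Ω, hΩ, rfl⟩ := hA
  constructor
  · intro C hC
    obtain ⟨v, -, rfl⟩ := Finset.mem_image.1 hC
    obtain ⟨D, hD, hvD⟩ := hΩ.isClustering.exists_mem v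
    exact ⟨D, hD, by simpa using hvD⟩
  · obtain ⟨Ω', hΩ', he⟩ := G.isLevel_components
    have he' : clusters Ω' = G.components := he
    exact he' ▸ hΩ.nested hΩ' zero_le

/-- The upper level of each pair is the lower level of the next pair, and `B` is the lower level of
the first pair. -/
def Linked {X : Type*} : X → List (X × X) → Prop
  | _, [] => True
  | B, (L, U) :: rest => L = B ∧ Linked U rest

end CostGraph

/-- All levels found so far, from the bottom upwards. -/
def SearchState.found {V : Type u} (s : SearchState V) : List (ℝ≥0 × Finset (Finset V)) :=
  s.levels ++ s.todo.map Prod.snd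

namespace CostGraph

variable {V : Type u} [Fintype V] [DecidableEq V]

/-- The invariant of the parametric search. -/
structure SearchInvariant (G : CostGraph V) (s : SearchState V) : Prop where
  linked : ∃ pre B, s.levels = pre ++ [B] ∧ Linked B s.todo
  isLevel : ∀ L ∈ s.found, G.IsLevel L
  chain : (s.found.map Prod.snd).Pairwise StrictlyNested
  complete : ∀ 𝒞 ∈ G.cutClusterings, 𝒞 ∈ s.found.map Prod.snd ∨
    ∃ p ∈ s.todo, StrictlyNested p.1.2 𝒞 ∧ StrictlyNested 𝒞 p.2.2
  calls : s.calls + 3 = s.found.length + s.levels.length ∨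
    s.calls = 0 ∧ s.todo = [] ∧ s.levels.length = 1

theorem searchInvariant_searchStart (G : CostGraph V) : G.SearchInvariant G.searchStart := by
  have hs := G.isLevel_singletons
  have hc := G.isLevel_components
  have hsc := (nested_of_mem_cutClusterings hc.mem_cutClusterings).1
  by_cases h : G.singletons = G.components
  · have hstart : G.searchStart = ⟨[], [(G.maxCost, G.singletons)], 0⟩ := by
      simp [searchStart, h]
    rw [hstart]
    refine ⟨⟨[], _, rfl, trivial⟩, ?_, by simp [SearchState.found], fun 𝒞 h𝒞 => Or.inl ?_,
      Or.inr ⟨rfl, rfl, rfl⟩⟩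
    · simpa [SearchState.found] using hs
    · obtain ⟨h1, h2⟩ := nested_of_mem_cutClusterings h𝒞
      obtain ⟨α, Ω, hΩ, rfl⟩ := h𝒞
      simpa [SearchState.found] using
        hΩ.isClustering.nested_antisymm hs.isClustering (h.symm ▸ h2) h1
  · have hstart : G.searchStart = ⟨[((G.maxCost, G.singletons), (0, G.components))],
        [(G.maxCost, G.singletons)], 0⟩ := by
      simp [searchStart, h]
    rw [hstart]
    refine ⟨⟨[], _, rfl, rfl, trivial⟩, ?_, ?_, fun 𝒞 h𝒞 => ?_, Or.inl rfl⟩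
    · simpa [SearchState.found] using ⟨hs, hc⟩
    · simpa [SearchState.found] using ⟨hsc, h⟩
    · obtain ⟨h1, h2⟩ := nested_of_mem_cutClusterings h𝒞
      simp only [SearchState.found, StrictlyNested, List.map_cons, List.map_nil, List.cons_append,
        List.nil_append, List.mem_cons, List.not_mem_nil, or_false, exists_eq_left]
      by_cases e1 : 𝒞 = G.singletons
      · exact Or.inl (Or.inl e1)
      by_cases e2 : 𝒞 = G.components
      · exact Or.inl (Or.inr e2)
      exact Or.inr ⟨⟨h1, Ne.symm e1⟩, h2, e2⟩

/-- The first pair of the search consists of two levels, and all levels output so far are nested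
in the lower one. -/
theorem SearchInvariant.head {G : CostGraph V} {L U : ℝ≥0 × Finset (Finset V)} {rest out n}
    (h : G.SearchInvariant ⟨(L, U) :: rest, out, n⟩) :
    (∃ pre, out = pre ++ [L]) ∧ G.IsLevel L ∧ G.IsLevel U ∧ StrictlyNested L.2 U.2 ∧
      Linked U rest ∧ (∀ O ∈ out, Nested O.2 L.2) := by
  obtain ⟨pre, B, rfl, rfl, hU⟩ : ∃ pre B, out = pre ++ [B] ∧ L = B ∧ Linked U rest := h.linked
  have hc := h.chain
  simp only [SearchState.found, List.map_append, List.map_cons,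
    List.append_assoc, List.cons_append, List.nil_append, List.pairwise_append,
    List.pairwise_cons] at hc
  refine ⟨⟨pre, rfl⟩, h.isLevel L (by simp [SearchState.found]),
    h.isLevel U (by simp [SearchState.found]), hc.2.1.1 _ (by simp), hU, fun O hO => ?_⟩
  rcases List.mem_append.1 hO with hO | hO
  · exact (hc.2.2 O.2 (List.mem_map_of_mem hO) L.2 (by simp)).1
  · rw [List.mem_singleton.1 hO]
    exact fun A hA => ⟨A, hA, subset_rfl⟩

/-- Closing a pair leaves the found levels unchanged and outputs one more; branching finds one more
and outputs none. Either way the call count and the sum of the two lengths both grow by one. The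
start has two found levels and one output, whence the `3`; the exceptional case of `calls` is the
trivial hierarchy with a single level. -/
theorem SearchInvariant.step {G : CostGraph V} {s s' : SearchState V} (h : G.SearchInvariant s)
    (hs : G.SearchStep s s') : G.SearchInvariant s' := by
  rcases hs with ⟨L, U, rest, out, n, α, Ω, hα, hΩ, he⟩ | ⟨L, U, rest, out, n, α, Ω, hα, hΩ, he⟩
  · obtain ⟨-, -, ⟨Ωj, hj, hUj⟩, hLU, hlink, -⟩ := h.head
    have hfound : (⟨rest, out ++ [U], n + 1⟩ : SearchState V).found =
        (⟨(L, U) :: rest, out, n⟩ : SearchState V).found := by simp [SearchState.found]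
    refine ⟨⟨out, U, rfl, hlink⟩, hfound ▸ h.isLevel, hfound ▸ h.chain, fun 𝒞 h𝒞 => ?_, ?_⟩
    · rw [hfound]
      refine (h.complete 𝒞 h𝒞).imp id ?_
      rintro ⟨p, hp, hp𝒞⟩
      rcases List.mem_cons.1 hp with rfl | hp
      -- The candidate returned the lower clustering, so the pair is consecutive and cannot hide a
      -- missing level.
      · rw [← he, ← hUj] at hα hLU
        rw [← he, ← hUj] at hp𝒞
        exact absurd hp𝒞 ((hα.consecutive hΩ hj hLU).2.2.2 𝒞 h𝒞)
      · exact ⟨p, hp, hp𝒞⟩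
    · rw [hfound]
      rcases h.calls with hn | ⟨-, hn, -⟩
      · left
        simp only [List.length_append, List.length_cons, List.length_nil] at hn ⊢
        omega
      · simp at hn
  · obtain ⟨⟨pre, hpre⟩, hL, hU, hLU, hlink, hout⟩ := h.head
    have hM : G.IsLevel (α, clusters Ω) := ⟨Ω, hΩ, rfl⟩
    have hLMU : StrictlyNested L.2 (clusters Ω) ∧ StrictlyNested (clusters Ω) U.2 := by
      obtain ⟨Ωi, hi, hLi⟩ := hL
      obtain ⟨Ωj, hj, hUj⟩ := hU
      rw [← hLi] at hLU hα he ⊢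
      rw [← hUj] at hLU hα ⊢
      obtain ⟨h1, h2⟩ := hα.strictlyNested hi hj hLU.1 hΩ
      exact ⟨⟨h1, he.symm⟩, h2⟩
    have hfound : (⟨(L, (α, clusters Ω)) :: ((α, clusters Ω), U) :: rest, out, n + 1⟩ :
        SearchState V).found = out ++ (α, clusters Ω) :: U :: rest.map Prod.snd := rfl
    have hfound' : (⟨(L, U) :: rest, out, n⟩ : SearchState V).found =
        out ++ U :: rest.map Prod.snd := rfl
    refine ⟨⟨pre, L, hpre, rfl, rfl, hlink⟩, ?_, ?_, fun 𝒞 h𝒞 => ?_, ?_⟩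
    · have := h.isLevel
      rw [hfound'] at this
      rw [hfound]
      intro X hX
      simp only [List.mem_append, List.mem_cons] at this hX
      rcases hX with hX | rfl | hX
      · exact this X (Or.inl hX)
      · exact hM
      · exact this X (Or.inr hX)
    · have := h.chain
      rw [hfound'] at this
      rw [hfound]
      simp only [List.map_append, List.map_cons, List.pairwise_append, List.pairwise_cons,
        List.mem_cons] at this ⊢
      obtain ⟨h1, ⟨h2, h3⟩, h4⟩ := this
      refine ⟨h1, ⟨?_, h2, h3⟩, fun A hA B hB => ?_⟩
      · rintro B (rfl | hB)
        · exact hLMU.2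
        · exact hLMU.2.trans_nested hM.isClustering hU.isClustering (h2 B hB).1
      · rcases hB with rfl | hB
        · obtain ⟨O, hO, rfl⟩ := List.mem_map.1 hA
          exact (hout O hO).trans_strictlyNested hL.isClustering hM.isClustering hLMU.1
        · exact h4 A hA B hB
    · rw [hfound]
      rcases h.complete 𝒞 h𝒞 with hmem | ⟨p, hp, hp1, hp2⟩
      · left
        rw [hfound'] at hmem
        simp only [List.map_append, List.map_cons, List.mem_append, List.mem_cons] at hmem ⊢
        tauto
      rcases List.mem_cons.1 hp with rfl | hp
      · by_cases hM𝒞 : 𝒞 = clusters Ω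
        · left; simp [hM𝒞]
        right
        -- A level missing between `L` and `U` is comparable with the new one and so falls into one
        -- of the two halves.
        rcases nested_or_nested h𝒞 hM.mem_cutClusterings with hn | hn
        · exact ⟨_, List.mem_cons_self, hp1, hn, hM𝒞⟩
        · exact ⟨_, List.mem_cons_of_mem _ List.mem_cons_self, ⟨hn, Ne.symm hM𝒞⟩, hp2⟩
      · exact Or.inr ⟨p, by simp [hp], hp1, hp2⟩
    · rw [hfound]
      have hn := h.calls
      rw [hfound'] at hn
      rcases hn with hn | ⟨-, hn, -⟩
      · left
        simp only [List.length_append, List.length_cons] at hn ⊢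
        omega
      · simp at hn

theorem SearchInvariant.exists_step {G : CostGraph V} {s : SearchState V}
    (h : G.SearchInvariant s) (hs : s.todo ≠ []) : ∃ s', G.SearchStep s s' := by
  obtain ⟨todo, out, n⟩ := s
  obtain _ | ⟨⟨L, U⟩, rest⟩ := todo
  · exact absurd rfl hs
  obtain ⟨-, hL, ⟨Ωj, hj, hUj⟩, hLU, -⟩ := h.head
  have hα : ∃ α, G.IsCandidate L.2 U.2 α := by
    rw [← hUj] at hLU ⊢
    exact CutC.exists_isCandidate hL.isClustering hj hLU
  obtain ⟨α, hα⟩ := hα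
  obtain ⟨Ω, hΩ⟩ := G.exists_cutC α
  by_cases he : clusters Ω = L.2
  · exact ⟨_, .advance L U rest out n α Ω hα hΩ he⟩
  · exact ⟨_, .branch L U rest out n α Ω hα hΩ he⟩

theorem SearchInvariant.nodup {G : CostGraph V} {s : SearchState V} (h : G.SearchInvariant s) :
    (s.found.map Prod.snd).Nodup :=
  h.chain.imp fun hAB => hAB.2

/-- The found clusterings form a strict chain, so they are distinct levels. -/
theorem SearchInvariant.length_found_le {G : CostGraph V} {s : SearchState V}
    (h : G.SearchInvariant s) : s.found.length ≤ G.cutClusterings.ncard := by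
  rw [← List.length_map (f := Prod.snd), ← List.toFinset_card_of_nodup h.nodup,
    ← Set.ncard_coe_finset]
  refine Set.ncard_le_ncard (fun 𝒞 h𝒞 => ?_) (Set.toFinite _)
  obtain ⟨L, hL, rfl⟩ := List.mem_map.1 (List.mem_toFinset.1 (Finset.mem_coe.1 h𝒞))
  exact (h.isLevel L hL).mem_cutClusterings

end CostGraph

theorem theorem1 :
    (∃ (P : RAM.Prog) (K : ℕ),
      ∀ (V : Type u) [Fintype V] [DecidableEq V] (G : CostGraph V) (αi αj : ℝ≥0)
        (Ωi Ωj : Finset (Finset V × V)),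
        G.CutC αi Ωi → G.CutC αj Ωj → αj < αi →
        StrictlyNested (clusters Ωi) (clusters Ωj) →
        -- every parent meets one of its children, so that the candidate is well defined
        (∀ C ∈ clusters Ωj, C ∉ clusters Ωi →
          ∃ l, IsGreatest (G.intersections (clusters Ωi) C) l) ∧
        ∃ αm : ℝ≥0, G.IsCandidate (clusters Ωi) (clusters Ωj) αm ∧
          -- it is computed in linear time
          (∀ m : RAM.Mem, RAM.IsInput G Ωi Ωj m →
            ∃ (m' : RAM.Mem) (n : ℕ), RAM.Exec P m m' n ∧ n ≤ K * Ωi.card ∧ m'.real 0 = αm) ∧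
          (αj < αm ∧ αm ≤ αi) ∧
          (∃ Ωm, G.CutC αm Ωm) ∧
          ∀ Ωm, G.CutC αm Ωm →
            Nested (clusters Ωi) (clusters Ωm) ∧
            StrictlyNested (clusters Ωm) (clusters Ωj) ∧
            (clusters Ωm = clusters Ωi →
              G.IsBreakpoint (clusters Ωi) (clusters Ωj) αm)) ∧
    -- the parametric search
    (∀ (V : Type u) [Fintype V] [DecidableEq V] (G : CostGraph V) (s : SearchState V),
      Relation.ReflTransGen G.SearchStep G.searchStart s →
      s.calls ≤ 2 * G.cutClusterings.ncard ∧
      (s.todo ≠ [] → ∃ s', G.SearchStep s s') ∧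
      (s.todo = [] →
        (∀ 𝒞, 𝒞 ∈ s.levels.map Prod.snd ↔ 𝒞 ∈ G.cutClusterings) ∧
        (s.levels.map Prod.snd).Pairwise StrictlyNested ∧
        (∀ L ∈ s.levels, IsClustering L.2 ∧ G.CutCReturns L.1 L.2) ∧
        s.levels.length = G.cutClusterings.ncard ∧
        (2 ≤ s.levels.length → s.calls = 2 * (s.levels.length - 2) + 1))) := by
  refine ⟨⟨RAM.candidateProg, 35, ?_⟩, ?_⟩
  · intro V _ _ G αi αj Ωi Ωj hi hj _ h
    refine ⟨fun C hC hCi => ?_, ?_⟩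
    · obtain ⟨l, hl, -⟩ := CostGraph.CutC.exists_isGreatest hi.isClustering hj h.1 hC hCi
      exact ⟨l, hl⟩
    obtain ⟨α, hα⟩ := CostGraph.CutC.exists_isCandidate hi.isClustering hj h
    refine ⟨α, hα, fun m hm => hα.reaches hi hj h.1 hm,
      ⟨hα.gt hi.isClustering hj h.1, hα.le hi⟩, G.exists_cutC α, fun Ω hΩ => ?_⟩
    obtain ⟨h1, h2⟩ := hα.strictlyNested hi hj h.1 hΩ
    refine ⟨h1, h2, fun he => ?_⟩
    -- The run for `αm` now takes the place of the run for `αi`, since the breakpoint lemma needs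
    -- the lower clustering to be returned for the candidate itself.
    rw [← he] at hα h ⊢
    exact hα.isBreakpoint hΩ hj h
  · intro V _ _ G s hs
    have hinv : G.SearchInvariant s := by
      induction hs with
      | refl => exact G.searchInvariant_searchStart
      | tail _ hst ih => exact ih.step hst
    have hlen := hinv.length_found_le
    have hle : s.levels.length ≤ s.found.length := by simp [SearchState.found]
    refine ⟨?_, hinv.exists_step, fun htodo => ?_⟩
    -- Every step makes one call, so this bound on reachable states also rules out an infinite
    -- search.
    · rcases hinv.calls with h | ⟨h, -⟩ <;> omega
    · have hfound : s.found = s.levels := by simp [SearchState.found, htodo]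
      have hmem : ∀ 𝒞, 𝒞 ∈ s.levels.map Prod.snd ↔ 𝒞 ∈ G.cutClusterings := by
        refine fun 𝒞 => ⟨fun h => ?_, fun h => ?_⟩
        · obtain ⟨L, hL, rfl⟩ := List.mem_map.1 h
          exact (hinv.isLevel L (hfound ▸ hL)).mem_cutClusterings
        · rcases hinv.complete 𝒞 h with h | ⟨p, hp, -⟩
          · rwa [hfound] at h
          · simp [htodo] at hp
      refine ⟨hmem, hfound ▸ hinv.chain, fun L hL => ?_, ?_, fun h2 => ?_⟩
      · have hlev := hinv.isLevel L (hfound ▸ hL)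
        refine ⟨hlev.isClustering, ?_⟩
        obtain ⟨Ω, hΩ, he⟩ := hlev
        exact he ▸ hΩ.returns
      · have hset : G.cutClusterings = ((s.levels.map Prod.snd).toFinset : Set _) := by
          ext 𝒞
          rw [← hmem]
          simp
        rw [hset, Set.ncard_coe_finset, List.toFinset_card_of_nodup (hfound ▸ hinv.nodup),
          List.length_map]
      · rcases hinv.calls with h | ⟨-, -, h⟩
        · rw [hfound] at h
          omega
        · omega
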